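/- For a labeled $d$-polytope $P\subset\mathbb R^d$ with $n$ vertices and $m$ facets, the centered realization space $\mathcal R(P)\subset\mathbb R^{d\times(n+m)}$ is the set of all pairs of matrices $(V,A)\in\mathbb R^{d\times n}\times\mathbb R^{d\times m}$ such that $\operatorname{conv}(V)=\{x\in\mathbb R^d : A^t x\le \mathbf 1\}$ and this polytope, with its vertices labeled by the columns of $V$ and its facets labeled by the columns of $A$ (the $j$-th facet being the one on which $a_j^t x=1$), realizes $P$, that is, there is an isomorphism between its face lattice and that of $P$ that respects the labels of vertices and facets. Let $C\subset\mathbb R^4$ be the 24-cell, the convex hull of the $24$ points $\pm e_i\pm e_j$ ($1\le i<j\le 4$), with any labeling of its $24$ vertices and $24$ facets. Let $(V,A)\in\mathcal R(C)\subset\mathbb R^{4\times 48}=\mathbb R^{192}$ be a point such that $\operatorname{conv}(V)$ is a regular polytope (its group of Euclidean symmetries acts transitively on its flags). Then $\mathcal R(C)$ is not a smooth submanifold of $\mathbb R^{192}$ at $(V,A)$: there is no $C^\infty$ diffeomorphism $\varphi$ from an open neighborhood $U$ of $(V,A)$ onto an open subset of $\mathbb R^{192}$ and no linear subspace $L\subset\mathbb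 R^{192}$ with $\varphi(U\cap\mathcal R(C))=\varphi(U)\cap L$. -/

import Mathlib

open scoped ContDiff

/-- Euclidean `d`-space. -/
abbrev EucSp (d : ℕ) : Type := EuclideanSpace ℝ (Fin d)

/-- The faces of a convex polytope `K`, including `∅` and `K` itself, ordered by inclusion.
A face is a set that is empty or consists of all the points of `K` where some linear functional
attains its maximum over `K`. -/
abbrev FaceLattice {d : ℕ} (K : Set (EucSp d)) : Type :=
  {F : Set (EucSp d) // IsExposed ℝ K F}

/-- `F` is a facet of `K ⊆ ℝ^d`: a face of dimension `d - 1`. -/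
def IsFacet {d : ℕ} (K F : Set (EucSp d)) : Prop :=
  IsExposed ℝ K F ∧ F.Nonempty ∧ Module.finrank ℝ (vectorSpan ℝ F) + 1 = d

/-- A labeled `d`-polytope in `ℝ^d` with `n` vertices and `m` facets: a full-dimensional convex
hull of finitely many points, together with an enumeration without repetition of its vertices
(the points that are faces) and of its facets. -/
structure LabeledPolytope (d n m : ℕ) where
  carrier : Set (EucSp d)
  isPolytope : ∃ s : Finset (EucSp d), carrier = convexHull ℝ (s : Set (EucSp d))
  fullDim : (interior carrier).Nonempty
  vertex : Fin n → EucSp d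
  vertex_injective : Function.Injective vertex
  range_vertex : Set.range vertex = {x | IsExposed ℝ carrier {x}}
  facet : Fin m → Set (EucSp d)
  facet_injective : Function.Injective facet
  range_facet : Set.range facet = {F | IsFacet carrier F}

namespace LabeledPolytope

variable {d n m : ℕ}

/-- The `i`-th vertex as an element of the face lattice. -/
def vertexFace (P : LabeledPolytope d n m) (i : Fin n) : FaceLattice P.carrier :=
  ⟨{P.vertex i}, by
    have h : P.vertex i ∈ {x | IsExposed ℝ P.carrier {x}} := P.range_vertex ▸ Set.mem_range_self i
    exact h⟩

/-- The `j`-th facet as an element of the face lattice. -/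
def facetFace (P : LabeledPolytope d n m) (j : Fin m) : FaceLattice P.carrier :=
  ⟨P.facet j, by
    have h : P.facet j ∈ {F | IsFacet P.carrier F} := P.range_facet ▸ Set.mem_range_self j
    exact h.1⟩

/-- `Q` realizes `P`: there is an isomorphism of face lattices that respects the labels of the
vertices and of the facets. -/
def Realizes (Q P : LabeledPolytope d n m) : Prop :=
  ∃ e : FaceLattice Q.carrier ≃o FaceLattice P.carrier,
    (∀ i, e (Q.vertexFace i) = P.vertexFace i) ∧ ∀ j, e (Q.facetFace j) = P.facetFace j

/-- The centered realization space of `P`: all pairs `(V, A)` (given by their columns) such that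
`conv V = {x | Aᵗ x ≤ 1}` is, with its vertices labeled by the columns of `V` and its facets by the
columns of `A`, a labeled polytope that realizes `P`. (Such a polytope contains the origin in its
interior.) -/
def centeredRealizationSpace (P : LabeledPolytope d n m) :
    Set ((Fin n → EucSp d) × (Fin m → EucSp d)) :=
  {p | ∃ Q : LabeledPolytope d n m,
    Q.carrier = convexHull ℝ (Set.range p.1) ∧
    Q.carrier = {x | ∀ j, inner ℝ (p.2 j) x ≤ 1} ∧
    (∀ i, Q.vertex i = p.1 i) ∧
    (∀ j, Q.facet j = {x ∈ Q.carrier | inner ℝ (p.2 j) x = 1}) ∧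
    Q.Realizes P}

end LabeledPolytope

/-- A convex polytope `K` is regular if its group of Euclidean symmetries acts transitively on the
flags (maximal chains) of its face lattice. -/
def IsRegularPolytope {d : ℕ} (K : Set (EucSp d)) : Prop :=
  ∀ c c' : Flag (FaceLattice K), ∃ σ : EucSp d ≃ᵃⁱ[ℝ] EucSp d,
    σ '' K = K ∧ ∀ F : FaceLattice K, F ∈ c → ∃ G ∈ c', (G : Set (EucSp d)) = σ '' F

/-- The 24-cell: the convex hull of the 24 points `±e_i ± e_j`, `i < j`, of `ℝ^4`. -/
def twentyFourCell : Set (EucSp 4) :=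
  convexHull ℝ {x | ∃ i j : Fin 4, i < j ∧ ∃ s t : ℝ, (s = 1 ∨ s = -1) ∧ (t = 1 ∨ t = -1) ∧
    x = EuclideanSpace.single i s + EuclideanSpace.single j t}

/-- Near the point `p`, the subset `S` of the normed space `E` is a smooth (embedded) submanifold:
some smooth chart of `E` around `p` straightens `S` to a linear subspace (of any dimension). -/
def IsSmoothSubmanifoldAt {E : Type*} [NormedAddCommGroup E] [NormedSpace ℝ E]
    (S : Set E) (p : E) : Prop :=
  ∃ (φ : OpenPartialHomeomorph E E) (L : Submodule ℝ E),
    p ∈ φ.source ∧ ContDiffOn ℝ ∞ φ φ.source ∧ ContDiffOn ℝ ∞ φ.symm φ.target ∧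
    ∀ x ∈ φ.source, x ∈ S ↔ φ x ∈ L

/-! Near any of its points the realization space is cut out by the incidence equations `⟪a_j, v_i⟫ =
1`, one for each vertex `i` on facet `j`: strict inequalities survive a small perturbation, and the
tight ones determine the face lattice (`eventually_mem_centeredRealizationSpace_iff`). The
obstruction to smoothness is therefore sought in these quadratic equations, to second order.

The 24-cell carries a self-stress: weights `ω_ij`, supported on incident pairs, with `∑_i ω_ij v_i =
0` for every `j` and `∑_j ω_ij a_j = 0` for every `i`. Differentiating the equations twice along a
`C²` curve and summing with these weights cancels the accelerations, so every velocity `(v', a')`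
satisfies `∑ ω_ij ⟪a_j', v_i'⟫ = 0` (`sum_cellStress_mul_inner_deriv_eq_zero`). On a smooth
submanifold the sum of two velocities is again the velocity of a `C²` curve
(`IsSmoothSubmanifoldAt.exists_curve_add`), so the sum would have to be isotropic too.

Two curves violate this. The hyperplanes orthogonal to `n = e_0` and `n = e_0 + e_1` cut only facets
parallel to `n`, so one half of the 24-cell can be stretched along `n` while the other half stays
fixed and all incidences persist (`inner_stretchCurve`). The sum of the two velocities takes the
value `-4` on the quadratic form (`sum_cellStress_mul_inner_stretch`).

This settles the standard 24-cell. A regular realization has edges of equal length, which makes its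
octahedral facets centrally symmetric; the resulting linear relations between vertices make it an
affine image of the standard one (`exists_continuousLinearEquiv`). Affine maps act on vertices and,
by the dual projective action, on normals, smoothly and preserving incidences, so the curves can be
carried back and forth. -/

/-! ### Polytopes given by vertices and by inequalities -/

/-- `K` is both the convex hull of the points `V i` and the solution set of `⟪A j, x⟫ ≤ 1`. -/
structure DoubleDescription {d n m : ℕ} (K : Set (EucSp d)) (V : Fin n → EucSp d)
    (A : Fin m → EucSp d) : Prop where
  eq_convexHull : K = convexHull ℝ (Set.range V)
  eq_halfspaces : K = {x | ∀ j, inner ℝ (A j) x ≤ 1}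

/-- The subset of `K` where all inequalities with index in `J` are tight. -/
def tightFace {d m : ℕ} (K : Set (EucSp d)) (A : Fin m → EucSp d) (J : Set (Fin m)) :
    Set (EucSp d) :=
  {x ∈ K | ∀ j ∈ J, inner ℝ (A j) x = 1}

/-- The inequalities that are tight on all of `F`. -/
def tightIndices {d m : ℕ} (A : Fin m → EucSp d) (F : Set (EucSp d)) : Set (Fin m) :=
  {j | ∀ x ∈ F, inner ℝ (A j) x = 1}

/-- By Krein–Milman: the extreme points of a face are extreme in the whole polytope, hence among the
generators. -/
theorem isExposed_eq_convexHull {d n : ℕ} {V : Fin n → EucSp d} {F : Set (EucSp d)}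
    (hF : IsExposed ℝ (convexHull ℝ (Set.range V)) F) :
    F = convexHull ℝ (V '' {i | V i ∈ F}) := by
  have hK : IsCompact (convexHull ℝ (Set.range V)) := Set.Finite.isCompact_convexHull ℝ (Set.finite_range V)
  have hconv : Convex ℝ F := hF.convex (convex_convexHull ℝ _)
  apply Set.Subset.antisymm
  · have hfin : (V '' {i | V i ∈ F}).Finite := Set.toFinite _
    have hsub : F.extremePoints ℝ ⊆ V '' {i | V i ∈ F} := by
      rw [hF.isExtreme.extremePoints_eq]
      rintro x ⟨hxF, hx⟩
      obtain ⟨i, rfl⟩ := extremePoints_convexHull_subset hx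
      exact ⟨i, hxF, rfl⟩
    calc F = closure (convexHull ℝ (F.extremePoints ℝ)) :=
          (closure_convexHull_extremePoints (hF.isCompact hK) hconv).symm
      _ ⊆ closure (convexHull ℝ (V '' {i | V i ∈ F})) := closure_mono (convexHull_mono hsub)
      _ = convexHull ℝ (V '' {i | V i ∈ F}) := (hfin.isClosed_convexHull ℝ).closure_eq
  · apply convexHull_min _ hconv
    rintro _ ⟨i, hi, rfl⟩
    exact hi

theorem exists_vertex_mem_of_isExposed {d n : ℕ} {V : Fin n → EucSp d} {F : Set (EucSp d)}
    (hF : IsExposed ℝ (convexHull ℝ (Set.range V)) F) (hne : F.Nonempty) : ∃ i, V i ∈ F := by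
  by_contra! h
  rw [isExposed_eq_convexHull hF] at hne
  simp [h] at hne

namespace DoubleDescription

variable {d n m : ℕ} {K : Set (EucSp d)} {V : Fin n → EucSp d} {A : Fin m → EucSp d}

theorem vertex_mem (h : DoubleDescription K V A) (i : Fin n) : V i ∈ K := by
  rw [h.eq_convexHull]
  exact subset_convexHull ℝ _ (Set.mem_range_self i)

theorem inner_le (h : DoubleDescription K V A) {x : EucSp d} (hx : x ∈ K) (j : Fin m) :
    inner ℝ (A j) x ≤ 1 := by
  rw [h.eq_halfspaces] at hx
  exact hx j

theorem convex (h : DoubleDescription K V A) : Convex ℝ K :=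
  h.eq_convexHull ▸ convex_convexHull ℝ _

theorem isCompact (h : DoubleDescription K V A) : IsCompact K :=
  h.eq_convexHull ▸ Set.Finite.isCompact_convexHull ℝ (Set.finite_range V)

theorem face_eq_convexHull (h : DoubleDescription K V A) {F : Set (EucSp d)}
    (hF : IsExposed ℝ K F) : F = convexHull ℝ (V '' {i | V i ∈ F}) := by
  rw [h.eq_convexHull] at hF
  exact isExposed_eq_convexHull hF

theorem exists_vertex_mem (h : DoubleDescription K V A) {F : Set (EucSp d)}
    (hF : IsExposed ℝ K F) (hne : F.Nonempty) : ∃ i, V i ∈ F := by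
  rw [h.eq_convexHull] at hF
  exact exists_vertex_mem_of_isExposed hF hne

/-- The sum of the functionals in `J` attains its upper bound exactly where each of them equals `1`.
-/
theorem isExposed_tightFace (h : DoubleDescription K V A) (J : Set (Fin m)) :
    IsExposed ℝ K (tightFace K A J) := by
  classical
  rintro ⟨x₀, hx₀, hx₀J⟩
  refine ⟨∑ j ∈ J.toFinset, innerSL ℝ (A j), ?_⟩
  have key : ∀ x ∈ K, (∑ j ∈ J.toFinset, innerSL ℝ (A j)) x ≤ ∑ j ∈ J.toFinset, (1 : ℝ) := by
    intro x hx
    rw [sum_apply]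
    exact Finset.sum_le_sum fun j _ => by simpa using h.inner_le hx j
  ext x
  constructor
  · rintro ⟨hx, hxJ⟩
    refine ⟨hx, fun y hy => (key y hy).trans (le_of_eq ?_)⟩
    rw [sum_apply]
    exact Finset.sum_congr rfl fun j hj => by simpa using (hxJ j (by simpa using hj)).symm
  · rintro ⟨hx, hmax⟩
    refine ⟨hx, fun j hj => ?_⟩
    have h1 : ∑ j ∈ J.toFinset, (1 : ℝ) ≤ ∑ j ∈ J.toFinset, inner ℝ (A j) x := by
      have := hmax x₀ hx₀
      rw [sum_apply, sum_apply] at this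
      refine le_trans (le_of_eq ?_) this
      exact Finset.sum_congr rfl fun j hj => by simpa using (hx₀J j (by simpa using hj)).symm
    have h2 : ∀ j ∈ J.toFinset, inner ℝ (A j) x ≤ 1 := fun j _ => h.inner_le hx j
    exact (Finset.sum_eq_sum_iff_of_le h2).1 (le_antisymm (Finset.sum_le_sum h2) h1) j (by simpa)

/-- The barycentre of the vertices of `F` works: an inequality tight there is tight at each of these
vertices, hence on all of `F`. It serves as a relative interior point of `F`. -/
theorem exists_mem_forall_inner_lt (h : DoubleDescription K V A) {F : Set (EucSp d)}
    (hF : IsExposed ℝ K F) (hne : F.Nonempty) :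
    ∃ c ∈ F, ∀ j, j ∉ tightIndices A F → inner ℝ (A j) c < 1 := by
  classical
  set s : Finset (Fin n) := Finset.univ.filter fun i => V i ∈ F with hs
  obtain ⟨i₀, hi₀⟩ := h.exists_vertex_mem hF hne
  have hi₀s : i₀ ∈ s := by simp [hs, hi₀]
  have hcard : (0 : ℝ) < s.card := by exact_mod_cast Finset.card_pos.2 ⟨i₀, hi₀s⟩
  set c : EucSp d := ∑ i ∈ s, (s.card : ℝ)⁻¹ • V i with hc
  have hcF : c ∈ F := by
    apply (hF.convex h.convex).sum_mem (fun i _ => by positivity)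
    · rw [Finset.sum_const, nsmul_eq_mul, mul_inv_cancel₀ hcard.ne']
    · intro i hi
      simpa [hs] using hi
  have hcK := hF.subset hcF
  refine ⟨c, hcF, fun j hj => ?_⟩
  refine lt_of_le_of_ne (h.inner_le hcK j) fun hj1 => hj ?_
  have hall : ∀ i ∈ s, inner ℝ (A j) (V i) = 1 := by
    have h2 : ∀ i ∈ s, (s.card : ℝ)⁻¹ * inner ℝ (A j) (V i) ≤ (s.card : ℝ)⁻¹ := fun i _ =>
      mul_le_of_le_one_right (by positivity) (h.inner_le (h.vertex_mem i) j)
    have h3 : ∑ i ∈ s, (s.card : ℝ)⁻¹ * inner ℝ (A j) (V i) = ∑ i ∈ s, (s.card : ℝ)⁻¹ := by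
      rw [Finset.sum_const, nsmul_eq_mul, mul_inv_cancel₀ hcard.ne', ← hj1, hc, inner_sum]
      exact Finset.sum_congr rfl fun i _ => by rw [inner_smul_right]
    intro i hi
    have := (Finset.sum_eq_sum_iff_of_le h2).1 h3 i hi
    exact mul_left_cancel₀ (inv_ne_zero hcard.ne') (by rw [this, mul_one])
  have hsub : F ⊆ {y | inner ℝ (A j) y = 1} := by
    rw [h.face_eq_convexHull hF]
    refine convexHull_min ?_ ?_
    · rintro _ ⟨i, hi, rfl⟩
      exact hall i (by simpa [hs] using hi)
    · exact convex_hyperplane (innerSL ℝ (A j)).toLinearMap.isLinear 1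
  exact fun y hy => hsub hy

theorem eq_tightFace (h : DoubleDescription K V A) {F : Set (EucSp d)} (hF : IsExposed ℝ K F)
    (hne : F.Nonempty) : F = tightFace K A (tightIndices A F) := by
  obtain ⟨l, hl⟩ := hF hne
  refine Set.Subset.antisymm (fun x hx => ⟨hF.subset hx, fun j hj => hj x hx⟩) ?_
  rintro x ⟨hxK, hx⟩
  obtain ⟨c, hcF, hslack⟩ := h.exists_mem_forall_inner_lt hF hne
  -- From the relative interior point `c`, a small step away from `x` stays in `K`; as `c` maximizes
  -- `l`, this forces `l x ≥ l c`.
  have hev : ∀ᶠ ε : ℝ in nhdsWithin 0 (Set.Ioi 0), ∀ j, inner ℝ (A j) (c - ε • (x - c)) ≤ 1 := by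
    rw [Filter.eventually_all]
    intro j
    by_cases hj : j ∈ tightIndices A F
    · refine Filter.Eventually.of_forall fun ε => le_of_eq ?_
      rw [inner_sub_right, inner_smul_right, inner_sub_right, hx j hj, hj c hcF]
      ring
    · have hcont : Continuous fun ε : ℝ => inner ℝ (A j) (c - ε • (x - c)) := by fun_prop
      have : ∀ᶠ ε : ℝ in nhds 0, inner ℝ (A j) (c - ε • (x - c)) < 1 :=
        hcont.continuousAt.eventually_lt continuousAt_const (by simpa using hslack j hj)
      exact (this.filter_mono nhdsWithin_le_nhds).mono fun _ => le_of_lt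
  obtain ⟨ε, hε, hεpos⟩ := (hev.and self_mem_nhdsWithin).exists
  have hεpos : 0 < ε := hεpos
  have hyK : c - ε • (x - c) ∈ K := by
    rw [h.eq_halfspaces]
    exact hε
  have hcF' := hcF
  rw [hl] at hcF' ⊢
  refine ⟨hxK, fun y hy => (hcF'.2 y hy).trans ?_⟩
  have := hcF'.2 _ hyK
  rw [map_sub, map_smul, map_sub, smul_eq_mul] at this
  have : 0 ≤ ε * (l x - l c) := by linarith
  linarith [nonneg_of_mul_nonneg_right this hεpos]

theorem mem_iff_of_mem_tightIndices (h : DoubleDescription K V A) {F : Set (EucSp d)}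
    (hF : IsExposed ℝ K F) (j : Fin m) :
    j ∈ tightIndices A F ↔ ∀ i, V i ∈ F → inner ℝ (A j) (V i) = 1 := by
  refine ⟨fun hj i hi => hj _ hi, fun hj => ?_⟩
  have hsub : F ⊆ {y | inner ℝ (A j) y = 1} := by
    rw [h.face_eq_convexHull hF]
    refine convexHull_min ?_ (convex_hyperplane (innerSL ℝ (A j)).toLinearMap.isLinear 1)
    rintro _ ⟨i, hi, rfl⟩
    exact hj i hi
  exact fun y hy => hsub hy

theorem subset_iff (h : DoubleDescription K V A) {F G : Set (EucSp d)}
    (hF : IsExposed ℝ K F) (hG : IsExposed ℝ K G) : F ⊆ G ↔ ∀ i, V i ∈ F → V i ∈ G := by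
  refine ⟨fun hFG i hi => hFG hi, fun hi => ?_⟩
  rw [h.face_eq_convexHull hF, h.face_eq_convexHull hG]
  exact convexHull_mono (Set.image_mono fun i => hi i)

theorem ext_vertices (h : DoubleDescription K V A) {F G : Set (EucSp d)}
    (hF : IsExposed ℝ K F) (hG : IsExposed ℝ K G) (hi : ∀ i, V i ∈ F ↔ V i ∈ G) : F = G :=
  Set.Subset.antisymm ((h.subset_iff hF hG).2 fun i => (hi i).1)
    ((h.subset_iff hG hF).2 fun i => (hi i).2)

/-- This lets the empty face, on which every index is vacuously tight, take part in the
correspondence between faces and index sets. A point `x` where everything is tight is nonzero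
because `0 < m`, and then the whole ray through `-x` lies in `K`, against compactness. -/
theorem tightFace_univ_eq_empty (h : DoubleDescription K V A) (hm : 0 < m) :
    tightFace K A Set.univ = ∅ := by
  rw [Set.eq_empty_iff_forall_notMem]
  rintro x ⟨hxK, hx⟩
  have hx0 : x ≠ 0 := by
    rintro rfl
    simpa using hx ⟨0, hm⟩ (Set.mem_univ _)
  have hpos : 0 < ‖x‖ := norm_pos_iff.2 hx0
  obtain ⟨R, hR⟩ := h.isCompact.isBounded.exists_norm_le
  have hR0 : 0 ≤ R := (norm_nonneg x).trans (hR x hxK)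
  have hmem : (-((R + 1) / ‖x‖)) • x ∈ K := by
    rw [h.eq_halfspaces]
    intro j
    rw [inner_smul_right, hx j (Set.mem_univ _)]
    have : 0 ≤ (R + 1) / ‖x‖ := by positivity
    linarith
  have := hR _ hmem
  rw [norm_smul, norm_neg, Real.norm_of_nonneg (by positivity), div_mul_cancel₀ _ hpos.ne'] at this
  linarith

end DoubleDescription

/-! ### The face lattice is determined by the incidences -/

/-- The vertices and facets of two polytopes have the same incidences. -/
def SameIncidences {d n m : ℕ} (V : Fin n → EucSp d) (A : Fin m → EucSp d)
    (V' : Fin n → EucSp d) (A' : Fin m → EucSp d) : Prop :=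
  ∀ i j, inner ℝ (A j) (V i) = 1 ↔ inner ℝ (A' j) (V' i) = 1

theorem SameIncidences.symm {d n m : ℕ} {V V' : Fin n → EucSp d} {A A' : Fin m → EucSp d}
    (h : SameIncidences V A V' A') : SameIncidences V' A' V A := fun i j => (h i j).symm

namespace DoubleDescription

variable {d n m : ℕ} {K K' : Set (EucSp d)} {V V' : Fin n → EucSp d} {A A' : Fin m → EucSp d}

theorem vertex_mem_tightFace_tightIndices_iff (h : DoubleDescription K V A)
    (h' : DoubleDescription K' V' A') (hI : SameIncidences V A V' A') (hm : 0 < m)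
    {F : Set (EucSp d)} (hF : IsExposed ℝ K F) (i : Fin n) :
    V' i ∈ tightFace K' A' (tightIndices A F) ↔ V i ∈ F := by
  have h1 : V' i ∈ tightFace K' A' (tightIndices A F) ↔ V i ∈ tightFace K A (tightIndices A F) := by
    simp only [tightFace, Set.mem_ofPred_eq, h.vertex_mem, h'.vertex_mem, true_and, hI i]
  rw [h1]
  rcases F.eq_empty_or_nonempty with rfl | hne
  · have : tightIndices A (∅ : Set (EucSp d)) = Set.univ := by ext; simp [tightIndices]
    rw [this, h.tightFace_univ_eq_empty hm]
  · rw [← h.eq_tightFace hF hne]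

/-- Polytopes with the same vertex-facet incidences have isomorphic face lattices. -/
theorem exists_orderIso (h : DoubleDescription K V A) (h' : DoubleDescription K' V' A')
    (hI : SameIncidences V A V' A') (hm : 0 < m) :
    ∃ e : FaceLattice K ≃o FaceLattice K', ∀ F i, V' i ∈ (e F).1 ↔ V i ∈ F.1 := by
  -- A face is recorded by its tight indices and rebuilt from them in the other polytope. Both maps
  -- preserve the set of vertex labels, which determines a face.
  let f : FaceLattice K → FaceLattice K' := fun F =>
    ⟨tightFace K' A' (tightIndices A F.1), h'.isExposed_tightFace _⟩
  let g : FaceLattice K' → FaceLattice K := fun F =>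
    ⟨tightFace K A (tightIndices A' F.1), h.isExposed_tightFace _⟩
  have hf : ∀ F i, V' i ∈ (f F).1 ↔ V i ∈ F.1 := fun F i =>
    h.vertex_mem_tightFace_tightIndices_iff h' hI hm F.2 i
  have hg : ∀ F i, V i ∈ (g F).1 ↔ V' i ∈ F.1 := fun F i =>
    h'.vertex_mem_tightFace_tightIndices_iff h hI.symm hm F.2 i
  refine ⟨⟨⟨f, g, fun F => Subtype.ext ?_, fun F => Subtype.ext ?_⟩, ?_⟩, hf⟩
  · exact h.ext_vertices (g (f F)).2 F.2 fun i => (hg _ i).trans (hf _ i)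
  · exact h'.ext_vertices (f (g F)).2 F.2 fun i => (hf _ i).trans (hg _ i)
  · intro F G
    change (f F).1 ⊆ (f G).1 ↔ F.1 ⊆ G.1
    rw [h.subset_iff F.2 G.2, h'.subset_iff (f F).2 (f G).2]
    simp only [hf]

end DoubleDescription

/-! ### Facets and their normals -/

theorem finrank_orthogonal_span_singleton_add_one {d : ℕ} {a : EucSp d} (ha : a ≠ 0) :
    Module.finrank ℝ (Submodule.span ℝ {a})ᗮ + 1 = d := by
  have := Submodule.finrank_add_finrank_orthogonal (Submodule.span ℝ {a})
  rw [finrank_span_singleton ha, finrank_euclideanSpace_fin] at this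
  omega

theorem mem_orthogonal_vectorSpan {d : ℕ} {a : EucSp d} {F : Set (EucSp d)}
    (ha : ∀ x ∈ F, inner ℝ a x = 1) : a ∈ (vectorSpan ℝ F)ᗮ := by
  rw [Submodule.mem_orthogonal']
  intro u hu
  have : vectorSpan ℝ F ≤ (Submodule.span ℝ {a})ᗮ := by
    rw [vectorSpan, Submodule.span_le]
    rintro _ ⟨x, hx, y, hy, rfl⟩
    rw [SetLike.mem_coe, Submodule.mem_orthogonal_singleton_iff_inner_right]
    simp only [vsub_eq_sub]
    rw [inner_sub_right, ha x hx, ha y hy, sub_self]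
  exact Submodule.mem_orthogonal_singleton_iff_inner_right.1 (this hu)

theorem ne_zero_of_inner_eq_one {d : ℕ} {a x : EucSp d} (h : inner ℝ a x = (1 : ℝ)) : a ≠ 0 := by
  rintro rfl
  simp at h

/-- The normal vector of a facet, normalized to take the value `1`, is unique. -/
theorem eq_of_inner_eq_one_of_finrank {d : ℕ} {a b : EucSp d} {F : Set (EucSp d)}
    (hne : F.Nonempty) (hd : Module.finrank ℝ (vectorSpan ℝ F) + 1 = d)
    (ha : ∀ x ∈ F, inner ℝ a x = 1) (hb : ∀ x ∈ F, inner ℝ b x = 1) : a = b := by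
  obtain ⟨x, hx⟩ := hne
  have h1 : Module.finrank ℝ (vectorSpan ℝ F)ᗮ = 1 := by
    have := Submodule.finrank_add_finrank_orthogonal (vectorSpan ℝ F)
    rw [finrank_euclideanSpace_fin] at this
    omega
  have ha0 : (⟨a, mem_orthogonal_vectorSpan ha⟩ : (vectorSpan ℝ F)ᗮ) ≠ 0 := fun h0 =>
    ne_zero_of_inner_eq_one (ha x hx) (congrArg Subtype.val h0)
  obtain ⟨c, hc⟩ := (finrank_eq_one_iff_of_nonzero' _ ha0).1 h1 ⟨b, mem_orthogonal_vectorSpan hb⟩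
  have hc' : c • a = b := congrArg Subtype.val hc
  have := hb x hx
  rw [← hc', real_inner_smul_left, ha x hx, mul_one] at this
  rw [← hc', this, one_smul]

namespace DoubleDescription

variable {d n m : ℕ} {K K' : Set (EucSp d)} {V V' : Fin n → EucSp d} {A A' : Fin m → EucSp d}

theorem mem_nhds_zero (h : DoubleDescription K V A) : K ∈ nhds 0 := by
  rw [h.eq_halfspaces]
  have : ∀ᶠ x : EucSp d in nhds 0, ∀ j, inner ℝ (A j) x < 1 := by
    rw [Filter.eventually_all]
    intro j
    have hcont : Continuous fun x : EucSp d => inner ℝ (A j) x := by fun_prop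
    exact hcont.continuousAt.eventually_lt continuousAt_const (by simp)
  exact this.mono fun x hx j => (hx j).le

theorem interior_nonempty (h : DoubleDescription K V A) : (interior K).Nonempty :=
  ⟨0, mem_interior_iff_mem_nhds.2 h.mem_nhds_zero⟩

theorem vectorSpan_eq_top (h : DoubleDescription K V A) : vectorSpan ℝ K = ⊤ := by
  have := (h.convex.interior_nonempty_iff_affineSpan_eq_top).1 h.interior_nonempty
  rw [← direction_affineSpan, this, AffineSubspace.direction_top]

/-- Where only inequality `j` is tight, a small step in any direction orthogonal to `A j` remains in
the face, so the face spans the full hyperplane direction. -/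
theorem finrank_vectorSpan_tightFace_singleton (h : DoubleDescription K V A) {j : Fin m}
    {x₀ : EucSp d} (hx₀ : x₀ ∈ tightFace K A {j}) (hlt : ∀ k, k ≠ j → inner ℝ (A k) x₀ < 1) :
    Module.finrank ℝ (vectorSpan ℝ (tightFace K A {j})) + 1 = d := by
  have hx₀j := hx₀.2 j rfl
  have key : vectorSpan ℝ (tightFace K A {j}) = (Submodule.span ℝ {A j})ᗮ := by
    apply le_antisymm
    · rw [Submodule.le_orthogonal_iff_le_orthogonal, Submodule.span_singleton_le_iff_mem]
      exact mem_orthogonal_vectorSpan fun x hx => hx.2 j rfl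
    · intro y hy
      rw [Submodule.mem_orthogonal_singleton_iff_inner_right] at hy
      have hev : ∀ᶠ ε : ℝ in nhdsWithin 0 (Set.Ioi 0), ∀ k, inner ℝ (A k) (x₀ + ε • y) ≤ 1 := by
        rw [Filter.eventually_all]
        intro k
        by_cases hk : k = j
        · subst hk
          refine Filter.Eventually.of_forall fun ε => le_of_eq ?_
          rw [inner_add_right, inner_smul_right, hy, hx₀j]
          ring
        · have hcont : Continuous fun ε : ℝ => inner ℝ (A k) (x₀ + ε • y) := by fun_prop
          have : ∀ᶠ ε : ℝ in nhds 0, inner ℝ (A k) (x₀ + ε • y) < 1 :=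
            hcont.continuousAt.eventually_lt continuousAt_const (by simpa using hlt k hk)
          exact (this.filter_mono nhdsWithin_le_nhds).mono fun _ => le_of_lt
      obtain ⟨ε, hε, hεpos⟩ := (hev.and self_mem_nhdsWithin).exists
      have hεpos : 0 < ε := hεpos
      have hz : x₀ + ε • y ∈ tightFace K A {j} := by
        refine ⟨by rw [h.eq_halfspaces]; exact hε, ?_⟩
        rintro k rfl
        rw [inner_add_right, inner_smul_right, hy, hx₀j]
        ring
      have := vsub_mem_vectorSpan ℝ hz hx₀
      rw [vsub_eq_sub, add_sub_cancel_left] at this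
      simpa [hεpos.ne'] using Submodule.smul_mem _ ε⁻¹ this
  rw [key]
  exact finrank_orthogonal_span_singleton_add_one (ne_zero_of_inner_eq_one hx₀j)

/-- By dimension a facet is not all of `K`, so some inequality is tight on it; uniqueness of the
normalized normal makes all the tight ones coincide. -/
theorem eq_tightFace_of_isFacet (h : DoubleDescription K V A) {F : Set (EucSp d)}
    (hF : IsFacet K F) : ∃ j, F = tightFace K A {j} := by
  obtain ⟨hexp, hne, hdim⟩ := hF
  have hJ : (tightIndices A F).Nonempty := by
    by_contra hJ
    rw [Set.not_nonempty_iff_eq_empty] at hJ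
    have hFK : F = K := by
      rw [h.eq_tightFace hexp hne, hJ]
      simp [tightFace]
    rw [hFK, h.vectorSpan_eq_top, finrank_top, finrank_euclideanSpace_fin] at hdim
    omega
  obtain ⟨j, hj⟩ := hJ
  refine ⟨j, ?_⟩
  conv_lhs => rw [h.eq_tightFace hexp hne]
  ext x
  refine and_congr_right fun _ => ⟨fun hx k hk => hk ▸ hx j hj, fun hx k hk => ?_⟩
  rw [eq_of_inner_eq_one_of_finrank hne hdim hk hj]
  exact hx j rfl

/-- Dimension is not visibly combinatorial, so it is transferred through tight sets. An index tight
on the whole face of `K'` is tight on the facet of `K`, hence equals `j` since distinct indices have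
distinct normals; the barycentre of the face of `K'` then has `j` as its only tight index. -/
theorem isFacet_tightFace_singleton (h : DoubleDescription K V A)
    (h' : DoubleDescription K' V' A') (hI : SameIncidences V A V' A')
    (hinj : Function.Injective A) {j : Fin m} (hj : IsFacet K (tightFace K A {j})) :
    IsFacet K' (tightFace K' A' {j}) := by
  obtain ⟨hexp, hne, hdim⟩ := hj
  have hexp' := h'.isExposed_tightFace (A := A') {j}
  have hiff : ∀ i, V i ∈ tightFace K A {j} ↔ V' i ∈ tightFace K' A' {j} := fun i => by
    simp only [tightFace, Set.mem_ofPred_eq, h.vertex_mem, h'.vertex_mem, true_and, hI i]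
  have hne' : (tightFace K' A' {j}).Nonempty := by
    obtain ⟨i, hi⟩ := h.exists_vertex_mem hexp hne
    exact ⟨_, (hiff i).1 hi⟩
  have hJ : ∀ k, k ∈ tightIndices A' (tightFace K' A' {j}) → k = j := by
    intro k hk
    rw [h'.mem_iff_of_mem_tightIndices hexp'] at hk
    apply hinj
    refine eq_of_inner_eq_one_of_finrank hne hdim ?_ fun x hx => hx.2 j rfl
    refine (h.mem_iff_of_mem_tightIndices hexp k).2 fun i hi => (hI i k).2 (hk i ((hiff i).1 hi))
  obtain ⟨c, hc, hlt⟩ := h'.exists_mem_forall_inner_lt hexp' hne'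
  exact ⟨hexp', hne', h'.finrank_vectorSpan_tightFace_singleton hc fun k hk =>
    hlt k fun hk' => hk (hJ k hk')⟩

theorem tightFace_singleton (K : Set (EucSp d)) (A : Fin m → EucSp d) (j : Fin m) :
    tightFace K A {j} = {x ∈ K | inner ℝ (A j) x = 1} := by
  simp [tightFace]

end DoubleDescription

namespace LabeledPolytope

variable {d n m : ℕ}

/-- Membership in the realization space is preserved by passing to another polytope with the same
vertex-facet incidences. -/
theorem mem_centeredRealizationSpace_of_sameIncidences (P : LabeledPolytope d n m) (hm : 0 < m)
    {p q : (Fin n → EucSp d) × (Fin m → EucSp d)} (hp : p ∈ P.centeredRealizationSpace)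
    {K : Set (EucSp d)} (hq : DoubleDescription K q.1 q.2)
    (hI : SameIncidences p.1 p.2 q.1 q.2) : q ∈ P.centeredRealizationSpace := by
  obtain ⟨Q, hQc, hQh, hQv, hQf, e, hev, hef⟩ := hp
  have hp : DoubleDescription Q.carrier p.1 p.2 := ⟨hQc, hQh⟩
  obtain ⟨Φ, hΦ⟩ := hp.exists_orderIso hq hI hm
  have hQf' : ∀ j, Q.facet j = tightFace Q.carrier p.2 {j} := fun j => by
    rw [hQf, DoubleDescription.tightFace_singleton]
  have hfacet : ∀ j, IsFacet Q.carrier (tightFace Q.carrier p.2 {j}) := fun j => by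
    have : Q.facet j ∈ {F | IsFacet Q.carrier F} := Q.range_facet ▸ Set.mem_range_self j
    rwa [hQf'] at this
  -- Equal normals would give equal facets, and the facets of `Q` are labeled without repetition.
  have hinj : Function.Injective p.2 := fun j k hjk => Q.facet_injective <| by
    rw [hQf, hQf, hjk]
  have hΦv : ∀ i, (Φ (Q.vertexFace i)).1 = {q.1 i} := by
    intro i
    rw [hq.face_eq_convexHull (Φ (Q.vertexFace i)).2]
    have h2 : {k | q.1 k ∈ (Φ (Q.vertexFace i)).1} = {i} := by
      ext k
      rw [Set.mem_ofPred_eq, hΦ]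
      simp only [vertexFace, Set.mem_singleton_iff, ← hQv]
      exact Q.vertex_injective.eq_iff
    rw [h2, Set.image_singleton, convexHull_singleton]
  have hΦf : ∀ j, (Φ (Q.facetFace j)).1 = tightFace K q.2 {j} := by
    intro j
    refine hq.ext_vertices (Φ (Q.facetFace j)).2 (hq.isExposed_tightFace _) fun i => ?_
    rw [hΦ]
    simp only [facetFace, hQf', tightFace, Set.mem_ofPred_eq, hp.vertex_mem, hq.vertex_mem,
      true_and, hI i]
  have hvinj : Function.Injective Q.vertexFace := fun i k hik =>
    Q.vertex_injective (Set.singleton_injective (congrArg Subtype.val hik))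
  have hfinj : Function.Injective Q.facetFace := fun i k hik =>
    Q.facet_injective (congrArg Subtype.val hik)
  let R : LabeledPolytope d n m :=
    { carrier := K
      isPolytope := by
        classical
        exact ⟨Finset.univ.image q.1, by rw [hq.eq_convexHull]; simp⟩
      fullDim := hq.interior_nonempty
      vertex := q.1
      vertex_injective := fun i k hik => hvinj <| Φ.injective <| Subtype.ext <| by
        rw [hΦv, hΦv, hik]
      range_vertex := by
        ext x
        constructor
        · rintro ⟨i, rfl⟩
          change IsExposed ℝ K {q.1 i}
          rw [← hΦv]
          exact (Φ _).2
        · intro hx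
          have hx : IsExposed ℝ K {x} := hx
          obtain ⟨i, hi⟩ := hq.exists_vertex_mem hx (Set.singleton_nonempty x)
          exact ⟨i, hi⟩
      facet := fun j => tightFace K q.2 {j}
      facet_injective := fun i k hik => hfinj <| Φ.injective <| Subtype.ext <| by
        rw [hΦf, hΦf]
        exact hik
      range_facet := by
        ext F
        constructor
        · rintro ⟨j, rfl⟩
          exact hp.isFacet_tightFace_singleton hq hI hinj (hfacet j)
        · intro hF
          obtain ⟨j, hj⟩ := hq.eq_tightFace_of_isFacet hF
          exact ⟨j, hj.symm⟩ }
  refine ⟨R, hq.eq_convexHull, hq.eq_halfspaces, fun _ => rfl,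
    fun j => DoubleDescription.tightFace_singleton _ _ _, Φ.symm.trans e, fun i => ?_, fun j => ?_⟩
  · have : R.vertexFace i = Φ (Q.vertexFace i) := Subtype.ext (hΦv i).symm
    rw [this, OrderIso.trans_apply, OrderIso.symm_apply_apply, hev]
  · have : R.facetFace j = Φ (Q.facetFace j) := Subtype.ext (hΦf j).symm
    rw [this, OrderIso.trans_apply, OrderIso.symm_apply_apply, hef]

end LabeledPolytope

/-! ### Stability of the incidences under perturbation -/

namespace DoubleDescription

variable {d n m : ℕ} {K : Set (EucSp d)} {V : Fin n → EucSp d} {A : Fin m → EucSp d}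

/-- On a sphere enclosing `K` every point strictly violates some inequality; by compactness this
persists for nearby `B`. The perturbed polyhedron is star-shaped about `0`, so it cannot reach
beyond that sphere. -/
theorem eventually_norm_lt (h : DoubleDescription K V A) :
    ∃ R : ℝ, ∀ᶠ B in nhds A, ∀ x : EucSp d, (∀ j, inner ℝ (B j) x ≤ 1) → ‖x‖ < R := by
  obtain ⟨R, hRpos, hR⟩ := h.isCompact.isBounded.exists_pos_norm_lt
  refine ⟨R, ?_⟩
  have hsph : ∀ᶠ B in nhds A, ∀ w ∈ Metric.sphere (0 : EucSp d) R, ∃ j, 1 < inner ℝ (B j) w := by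
    refine (isCompact_sphere _ _).eventually_forall_of_forall_eventually fun w hw => ?_
    have hwK : w ∉ K := fun hwK => (hR w hwK).ne (by simpa using hw)
    rw [h.eq_halfspaces] at hwK
    simp only [Set.mem_ofPred_eq, not_forall, not_le] at hwK
    obtain ⟨j, hj⟩ := hwK
    have hcont : Continuous fun z : (Fin m → EucSp d) × EucSp d => inner ℝ (z.1 j) z.2 := by
      fun_prop
    exact (continuousAt_const.eventually_lt hcont.continuousAt hj).mono fun z hz => ⟨j, hz⟩
  filter_upwards [hsph] with B hB x hx
  by_contra! hle
  have hxpos : 0 < ‖x‖ := hRpos.trans_le hle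
  obtain ⟨j, hj⟩ := hB ((R / ‖x‖) • x) (by
    rw [mem_sphere_zero_iff_norm, norm_smul, Real.norm_of_nonneg (by positivity),
      div_mul_cancel₀ _ hxpos.ne'])
  rw [inner_smul_right] at hj
  have h1 : R / ‖x‖ ≤ 1 := (div_le_one hxpos).2 hle
  have h0 : 0 < R / ‖x‖ := by positivity
  nlinarith [hx j]

/-- Sets of inequalities which are not simultaneously tight on `K` stay so under perturbation. -/
theorem eventually_not_tight (h : DoubleDescription K V A) :
    ∀ᶠ B in nhds A, ∀ x : EucSp d, (∀ j, inner ℝ (B j) x ≤ 1) →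
      ∃ i, ∀ j, inner ℝ (B j) x = 1 → inner ℝ (A j) (V i) = 1 := by
  obtain ⟨R, hR⟩ := h.eventually_norm_lt
  have hball : ∀ᶠ B in nhds A, ∀ x ∈ Metric.closedBall (0 : EucSp d) R,
      (∀ j, inner ℝ (B j) x ≤ 1) → ∃ i, ∀ j, inner ℝ (B j) x = 1 → inner ℝ (A j) (V i) = 1 := by
    refine (isCompact_closedBall _ _).eventually_forall_of_forall_eventually fun x _ => ?_
    by_cases hxK : ∀ j, inner ℝ (A j) x ≤ 1
    · have hxK' : x ∈ K := by rw [h.eq_halfspaces]; exact hxK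
      -- Near `(A, x)` only inequalities already tight at `x` can be tight, and all of these are
      -- tight at any vertex of the smallest face containing `x`.
      obtain ⟨i, hi⟩ := h.exists_vertex_mem (h.isExposed_tightFace {j | inner ℝ (A j) x = 1})
        ⟨x, hxK', fun j hj => hj⟩
      have hne : ∀ᶠ z : (Fin m → EucSp d) × EucSp d in nhds (A, x),
          ∀ j, inner ℝ (A j) x ≠ 1 → inner ℝ (z.1 j) z.2 ≠ 1 := by
        rw [Filter.eventually_all]
        intro j
        have hcont : Continuous fun z : (Fin m → EucSp d) × EucSp d => inner ℝ (z.1 j) z.2 := by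
          fun_prop
        by_cases hj : inner ℝ (A j) x = (1 : ℝ)
        · exact Filter.Eventually.of_forall fun _ hj' => absurd hj hj'
        · exact (hcont.continuousAt.eventually_ne hj).mono fun z hz _ => hz
      refine hne.mono fun z hz _ => ⟨i, fun j hj => hi.2 j ?_⟩
      by_contra hj'
      exact hz j hj' hj
    · push Not at hxK
      obtain ⟨j, hj⟩ := hxK
      have hcont : Continuous fun z : (Fin m → EucSp d) × EucSp d => inner ℝ (z.1 j) z.2 := by
        fun_prop
      exact (continuousAt_const.eventually_lt hcont.continuousAt hj).mono fun z hz hle =>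
        absurd (hle j) (not_le.2 hz)
  filter_upwards [hR, hball] with B hB hB' x hx
  exact hB' x (by simpa using (hB x hx).le) hx

/-- Otherwise `w` would be the midpoint of the feasible points `w ± ε • y`. -/
theorem eq_zero_of_mem_extremePoints {w y : EucSp d}
    (hw : w ∈ Set.extremePoints ℝ {x : EucSp d | ∀ j, inner ℝ (A j) x ≤ 1})
    (hy : ∀ j, inner ℝ (A j) w = 1 → inner ℝ (A j) y = 0) : y = 0 := by
  have hev : ∀ᶠ ε : ℝ in nhds 0, ∀ j, inner ℝ (A j) (w + ε • y) ≤ 1 := by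
    rw [Filter.eventually_all]
    intro j
    by_cases hj : inner ℝ (A j) w = (1 : ℝ)
    · refine Filter.Eventually.of_forall fun ε => le_of_eq ?_
      rw [inner_add_right, inner_smul_right, hy j hj, hj]
      ring
    · have hcont : Continuous fun ε : ℝ => inner ℝ (A j) (w + ε • y) := by fun_prop
      have : ∀ᶠ ε : ℝ in nhds 0, inner ℝ (A j) (w + ε • y) < 1 :=
        hcont.continuousAt.eventually_lt continuousAt_const
          (by simpa using lt_of_le_of_ne (hw.1 j) hj)
      exact this.mono fun _ => le_of_lt
  have hneg : Filter.Tendsto (fun ε : ℝ => -ε) (nhds 0) (nhds 0) := by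
    simpa using (continuous_neg (G := ℝ)).tendsto 0
  have hboth := (hev.and (hneg.eventually hev)).filter_mono
    (nhdsWithin_le_nhds (s := Set.Ioi (0 : ℝ)))
  obtain ⟨ε, ⟨h1, h2⟩, hεpos⟩ := (hboth.and self_mem_nhdsWithin).exists
  have hεpos : 0 < ε := hεpos
  have hmid : w ∈ openSegment ℝ (w + ε • y) (w + (-ε) • y) :=
    ⟨1 / 2, 1 / 2, by norm_num, by norm_num, by norm_num, by module⟩
  have := (mem_extremePoints.1 hw).2 _ h1 _ h2 hmid
  have h3 : ε • y = 0 := by simpa using this.1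
  exact (smul_eq_zero.1 h3).resolve_left hεpos.ne'

/-- The incidence equations determine the combinatorial type of a polytope near a given one. -/
theorem eventually_doubleDescription (h : DoubleDescription K V A) :
    ∀ᶠ q : (Fin n → EucSp d) × (Fin m → EucSp d) in nhds (V, A),
      (∀ i j, inner ℝ (A j) (V i) = 1 → inner ℝ (q.2 j) (q.1 i) = 1) →
        SameIncidences V A q.1 q.2 ∧
          DoubleDescription (convexHull ℝ (Set.range q.1)) q.1 q.2 := by
  obtain ⟨R, hR⟩ := h.eventually_norm_lt
  have hlt : ∀ᶠ q : (Fin n → EucSp d) × (Fin m → EucSp d) in nhds (V, A),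
      ∀ i j, inner ℝ (A j) (V i) ≠ 1 → inner ℝ (q.2 j) (q.1 i) < 1 := by
    rw [Filter.eventually_all]
    intro i
    rw [Filter.eventually_all]
    intro j
    have hcont : Continuous fun q : (Fin n → EucSp d) × (Fin m → EucSp d) =>
      inner ℝ (q.2 j) (q.1 i) := by fun_prop
    by_cases hj : inner ℝ (A j) (V i) = (1 : ℝ)
    · exact Filter.Eventually.of_forall fun _ hj' => absurd hj hj'
    · exact (hcont.continuousAt.eventually_lt continuousAt_const
        (lt_of_le_of_ne (h.inner_le (h.vertex_mem i) j) hj)).mono fun _ hz _ => hz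
  have hsnd : Filter.Tendsto Prod.snd (nhds (V, A)) (nhds A) := continuous_snd.tendsto (V, A)
  filter_upwards [hlt, hsnd.eventually hR, hsnd.eventually h.eventually_not_tight]
    with q hq hqR hqt hinc
  have hI : SameIncidences V A q.1 q.2 := fun i j =>
    ⟨hinc i j, fun hj => by_contra fun hne => (hq i j hne).ne hj⟩
  refine ⟨hI, rfl, ?_⟩
  set L : Set (EucSp d) := {x | ∀ j, inner ℝ (q.2 j) x ≤ 1} with hL
  have hLconv : Convex ℝ L := by
    rw [hL, Set.ofPred_forall]
    exact convex_iInter fun j => convex_halfSpace_le (innerSL ℝ (q.2 j)).toLinearMap.isLinear 1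
  have hLclosed : IsClosed L := by
    rw [hL, Set.ofPred_forall]
    exact isClosed_iInter fun j => isClosed_le (by fun_prop) continuous_const
  have hLcomp : IsCompact L := by
    refine Metric.isCompact_of_isClosed_isBounded hLclosed
      ((Metric.isBounded_ball (x := (0 : EucSp d)) (r := R)).subset fun x hx => ?_)
    simpa using hqR x hx
  apply Set.Subset.antisymm
  · apply convexHull_min _ hLconv
    rintro _ ⟨i, rfl⟩ j
    by_cases hj : inner ℝ (A j) (V i) = (1 : ℝ)
    · exact (hinc i j hj).le
    · exact (hq i j hj).le
  · have hsub : L.extremePoints ℝ ⊆ Set.range q.1 := by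
      intro w hw
      -- The inequalities tight at `w` are among those incident to vertex `i` originally, hence also
      -- tight at `q.1 i`. Their normals annihilate `w - q.1 i`, and `w` is extreme, so the two
      -- points agree.
      obtain ⟨i, hi⟩ := hqt w hw.1
      refine ⟨i, (sub_eq_zero.1 (eq_zero_of_mem_extremePoints hw fun j hj => ?_)).symm⟩
      rw [inner_sub_right, hj, hinc i j (hi j hj), sub_self]
    calc L = closure (convexHull ℝ (L.extremePoints ℝ)) :=
          (closure_convexHull_extremePoints hLcomp hLconv).symm
      _ ⊆ closure (convexHull ℝ (Set.range q.1)) := closure_mono (convexHull_mono hsub)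
      _ = convexHull ℝ (Set.range q.1) :=
          ((Set.finite_range q.1).isClosed_convexHull ℝ).closure_eq

end DoubleDescription

namespace LabeledPolytope

variable {d n m : ℕ}

theorem exists_doubleDescription (P : LabeledPolytope d n m)
    {p : (Fin n → EucSp d) × (Fin m → EucSp d)} (hp : p ∈ P.centeredRealizationSpace) :
    ∃ K, DoubleDescription K p.1 p.2 := by
  obtain ⟨Q, hQc, hQh, -⟩ := hp
  exact ⟨_, hQc, hQh⟩

theorem inner_eq_one_iff (P : LabeledPolytope d n m)
    {p : (Fin n → EucSp d) × (Fin m → EucSp d)} (hp : p ∈ P.centeredRealizationSpace)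
    (i : Fin n) (j : Fin m) : inner ℝ (p.2 j) (p.1 i) = 1 ↔ P.vertex i ∈ P.facet j := by
  obtain ⟨Q, hQc, hQh, hQv, hQf, e, hev, hef⟩ := hp
  have hp : DoubleDescription Q.carrier p.1 p.2 := ⟨hQc, hQh⟩
  have h1 : P.vertex i ∈ P.facet j ↔ P.vertexFace i ≤ P.facetFace j :=
    (Set.singleton_subset_iff (s := P.facet j)).symm
  have h2 : Q.vertexFace i ≤ Q.facetFace j ↔ Q.vertex i ∈ Q.facet j :=
    Set.singleton_subset_iff
  rw [h1, ← hev, ← hef, OrderIso.le_iff_le, h2, hQf, hQv]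
  simp [hp.vertex_mem]

/-- Near one of its points, the realization space is cut out by the incidence equations. -/
theorem eventually_mem_centeredRealizationSpace_iff (P : LabeledPolytope d n m) (hm : 0 < m)
    {p : (Fin n → EucSp d) × (Fin m → EucSp d)} (hp : p ∈ P.centeredRealizationSpace) :
    ∀ᶠ q in nhds p, q ∈ P.centeredRealizationSpace ↔
      ∀ i j, P.vertex i ∈ P.facet j → inner ℝ (q.2 j) (q.1 i) = 1 := by
  obtain ⟨K, hK⟩ := P.exists_doubleDescription hp
  filter_upwards [hK.eventually_doubleDescription] with q hq
  refine ⟨fun hqP i j hij => (P.inner_eq_one_iff hqP i j).2 hij, fun hinc => ?_⟩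
  obtain ⟨hI, hdd⟩ := hq fun i j hij => hinc i j ((P.inner_eq_one_iff hp i j).1 hij)
  exact P.mem_centeredRealizationSpace_of_sameIncidences hm hp hdd hI

end LabeledPolytope

/-! ### First- and second-order calculus along curves -/

/-- The tangent vectors of curves in a smooth submanifold can be added. -/
theorem IsSmoothSubmanifoldAt.exists_curve_add {E : Type*} [NormedAddCommGroup E]
    [NormedSpace ℝ E] [FiniteDimensional ℝ E] {S : Set E} {p : E}
    (hS : IsSmoothSubmanifoldAt S p) {c₁ c₂ : ℝ → E} {u₁ u₂ : E}
    (h₁ : HasDerivAt c₁ u₁ 0) (h₂ : HasDerivAt c₂ u₂ 0) (h₁p : c₁ 0 = p) (h₂p : c₂ 0 = p)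
    (h₁S : ∀ᶠ s in nhds 0, c₁ s ∈ S) (h₂S : ∀ᶠ s in nhds 0, c₂ s ∈ S) :
    ∃ c : ℝ → E, ContDiffAt ℝ 2 c 0 ∧ c 0 = p ∧ HasDerivAt c (u₁ + u₂) 0 ∧
      ∀ᶠ s in nhds 0, c s ∈ S := by
  obtain ⟨φ, L, hp, hφ, hφs, hSL⟩ := hS
  have hsrc : φ.source ∈ nhds p := φ.open_source.mem_nhds hp
  have htgt : φ.target ∈ nhds (φ p) := φ.open_target.mem_nhds (φ.map_source hp)
  have hdφ : DifferentiableAt ℝ φ p := (hφ.contDiffAt hsrc).differentiableAt (by simp)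
  have hψ : ContDiffAt ℝ ∞ φ.symm (φ p) := hφs.contDiffAt htgt
  have hdψ : DifferentiableAt ℝ φ.symm (φ p) := hψ.differentiableAt (by simp)
  set D := fderiv ℝ φ p with hD
  set D' := fderiv ℝ φ.symm (φ p) with hD'
  have hinv : ∀ u, D' (D u) = u := by
    have h1 : HasFDerivAt (φ.symm ∘ φ) (D'.comp D) p :=
      hdψ.hasFDerivAt.comp p hdφ.hasFDerivAt
    have h2 : HasFDerivAt (φ.symm ∘ φ) (ContinuousLinearMap.id ℝ E) p :=
      (hasFDerivAt_id p).congr_of_eventuallyEq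
        (Filter.eventually_of_mem hsrc fun x hx => φ.left_inv hx)
    intro u
    exact DFunLike.congr_fun (h1.unique h2) u
  have htan : ∀ (c : ℝ → E) (u : E), HasDerivAt c u 0 → c 0 = p → (∀ᶠ s in nhds 0, c s ∈ S) →
      φ p ∈ L ∧ D u ∈ L := by
    intro c u hc hcp hcS
    have hcsrc : ∀ᶠ s in nhds 0, c s ∈ φ.source :=
      hc.continuousAt.eventually_mem (by rwa [hcp])
    have hcL : ∀ᶠ s in nhds 0, φ (c s) ∈ L := by
      filter_upwards [hcS, hcsrc] with s hs hs'
      exact (hSL _ hs').1 hs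
    have hpL : φ p ∈ L := hcp ▸ hcL.self_of_nhds
    refine ⟨hpL, ?_⟩
    have hd : HasDerivAt (fun s => φ (c s)) (D u) 0 := by
      have h1 : HasFDerivAt φ D (c 0) := by rw [hcp]; exact hdφ.hasFDerivAt
      exact h1.comp_hasDerivAt 0 hc
    have hlim := hd.tendsto_slope
    -- The derivative is a limit of difference quotients lying in `L`, which is closed by finite
    -- dimension.
    have hclosed : IsClosed (L : Set E) := L.closed_of_finiteDimensional
    refine hclosed.mem_of_tendsto hlim ?_
    filter_upwards [hcL.filter_mono nhdsWithin_le_nhds] with s hs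
    rw [slope_def_module]
    refine L.smul_mem _ (L.sub_mem hs ?_)
    rwa [hcp]
  obtain ⟨hpL, hu₁⟩ := htan c₁ u₁ h₁ h₁p h₁S
  obtain ⟨-, hu₂⟩ := htan c₂ u₂ h₂ h₂p h₂S
  -- In the chart both tangent vectors lie in `L`, so the line through `φ p` in the direction of
  -- their sum stays in `L`; its preimage is the required curve.
  have hline : HasDerivAt (fun s : ℝ => φ p + s • D (u₁ + u₂)) (D (u₁ + u₂)) 0 := by
    simpa using ((hasDerivAt_id (0 : ℝ)).smul_const (D (u₁ + u₂))).const_add (φ p)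
  refine ⟨fun s => φ.symm (φ p + s • D (u₁ + u₂)), ?_, ?_, ?_, ?_⟩
  · have h1 : ContDiffAt ℝ ∞ φ.symm (φ p + (0 : ℝ) • D (u₁ + u₂)) := by simpa using hψ
    have h2 : ContDiffAt ℝ ∞ (fun s : ℝ => φ p + s • D (u₁ + u₂)) 0 := by fun_prop
    exact (h1.comp 0 h2).of_le (WithTop.coe_le_coe.2 le_top)
  · simp [φ.left_inv hp]
  · have h1 : HasFDerivAt φ.symm D' (φ p + (0 : ℝ) • D (u₁ + u₂)) := by
      simpa using hdψ.hasFDerivAt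
    have := h1.comp_hasDerivAt 0 hline
    rwa [hinv] at this
  · have htgt' : ∀ᶠ s : ℝ in nhds 0, φ p + s • D (u₁ + u₂) ∈ φ.target :=
      hline.continuousAt.eventually_mem (by simpa using htgt)
    filter_upwards [htgt'] with s hs
    rw [hSL _ (φ.map_target hs), φ.right_inv hs, map_add]
    exact L.add_mem hpL (L.smul_mem _ (L.add_mem hu₁ hu₂))

/-- Second-order condition along a curve on which a bilinear expression is constant. -/
theorem inner_second_order {E : Type*} [NormedAddCommGroup E] [InnerProductSpace ℝ E]
    {v a : ℝ → E} (hv : ContDiffAt ℝ 2 v 0) (ha : ContDiffAt ℝ 2 a 0)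
    (h : ∀ᶠ s in nhds 0, inner ℝ (a s) (v s) = (1 : ℝ)) :
    inner ℝ (a 0) (deriv (deriv v) 0) + inner ℝ (deriv (deriv a) 0) (v 0) +
      2 * inner ℝ (deriv a 0) (deriv v 0) = 0 := by
  have key : ∀ {f : ℝ → E}, ContDiffAt ℝ 2 f 0 →
      (∀ᶠ s in nhds 0, HasDerivAt f (deriv f s) s) ∧
        HasDerivAt (deriv f) (deriv (deriv f) 0) 0 := by
    intro f hf
    constructor
    · filter_upwards [hf.eventually (by simp)] with s hs
      exact (hs.differentiableAt (by simp)).hasDerivAt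
    · have : ContDiffAt ℝ 1 (deriv f) 0 :=
        ContDiffAt.derivWithin hf (by norm_num)
      exact (this.differentiableAt (by simp)).hasDerivAt
  obtain ⟨hv1, hv2⟩ := key hv
  obtain ⟨ha1, ha2⟩ := key ha
  have h0 : ∀ᶠ s in nhds (0 : ℝ),
      inner ℝ (a s) (deriv v s) + inner ℝ (deriv a s) (v s) = (0 : ℝ) := by
    filter_upwards [h.eventually_nhds, hv1, ha1] with s hs hvs has
    have h1 := has.inner ℝ hvs
    have h2 : HasDerivAt (fun t => inner ℝ (a t) (v t)) (0 : ℝ) s :=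
      (hasDerivAt_const s (1 : ℝ)).congr_of_eventuallyEq hs
    exact h1.unique h2
  have h1 := (ha1.self_of_nhds.inner ℝ hv2).add (ha2.inner ℝ hv1.self_of_nhds)
  have h2 : HasDerivAt ((fun t => inner ℝ (a t) (deriv v t)) +
      fun t => inner ℝ (deriv a t) (v t)) (0 : ℝ) 0 :=
    (hasDerivAt_const 0 (0 : ℝ)).congr_of_eventuallyEq h0
  have := h1.unique h2
  linarith

/-! ### Combinatorics of the 24-cell -/

/-- The vertices of the 24-cell. -/
def cellVertex : Fin 24 → Fin 4 → ℤ :=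
  ![![1, 1, 0, 0], ![1, -1, 0, 0], ![-1, 1, 0, 0], ![-1, -1, 0, 0],
    ![1, 0, 1, 0], ![1, 0, -1, 0], ![-1, 0, 1, 0], ![-1, 0, -1, 0],
    ![1, 0, 0, 1], ![1, 0, 0, -1], ![-1, 0, 0, 1], ![-1, 0, 0, -1],
    ![0, 1, 1, 0], ![0, 1, -1, 0], ![0, -1, 1, 0], ![0, -1, -1, 0],
    ![0, 1, 0, 1], ![0, 1, 0, -1], ![0, -1, 0, 1], ![0, -1, 0, -1],
    ![0, 0, 1, 1], ![0, 0, 1, -1], ![0, 0, -1, 1], ![0, 0, -1, -1]]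

/-- Twice the facet normals of the 24-cell. -/
def cellNormal : Fin 24 → Fin 4 → ℤ :=
  ![![2, 0, 0, 0], ![-2, 0, 0, 0], ![0, 2, 0, 0], ![0, -2, 0, 0],
    ![0, 0, 2, 0], ![0, 0, -2, 0], ![0, 0, 0, 2], ![0, 0, 0, -2],
    ![1, 1, 1, 1], ![1, 1, 1, -1], ![1, 1, -1, 1], ![1, 1, -1, -1],
    ![1, -1, 1, 1], ![1, -1, 1, -1], ![1, -1, -1, 1], ![1, -1, -1, -1],
    ![-1, 1, 1, 1], ![-1, 1, 1, -1], ![-1, 1, -1, 1], ![-1, 1, -1, -1],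
    ![-1, -1, 1, 1], ![-1, -1, 1, -1], ![-1, -1, -1, 1], ![-1, -1, -1, -1]]

/-- The three pairs of opposite vertices in each octahedral facet of the 24-cell. -/
def cellOctahedron : Fin 24 → Fin 3 → Fin 2 → Fin 24 :=
  ![![![0, 1], ![4, 5], ![8, 9]], ![![2, 3], ![6, 7], ![10, 11]], ![![0, 2], ![12, 13], ![16, 17]],
    ![![1, 3], ![14, 15], ![18, 19]], ![![4, 6], ![12, 14], ![20, 21]], ![![5, 7], ![13, 15], ![22, 23]],
    ![![8, 10], ![16, 18], ![20, 22]], ![![9, 11], ![17, 19], ![21, 23]], ![![0, 20], ![4, 16], ![8, 12]],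
    ![![0, 21], ![4, 17], ![9, 12]], ![![0, 22], ![5, 16], ![8, 13]], ![![0, 23], ![5, 17], ![9, 13]],
    ![![1, 20], ![4, 18], ![8, 14]], ![![1, 21], ![4, 19], ![9, 14]], ![![1, 22], ![5, 18], ![8, 15]],
    ![![1, 23], ![5, 19], ![9, 15]], ![![2, 20], ![6, 16], ![10, 12]], ![![2, 21], ![6, 17], ![11, 12]],
    ![![2, 22], ![7, 16], ![10, 13]], ![![2, 23], ![7, 17], ![11, 13]], ![![3, 20], ![6, 18], ![10, 14]],
    ![![3, 21], ![6, 19], ![11, 14]], ![![3, 22], ![7, 18], ![10, 15]], ![![3, 23], ![7, 19], ![11, 15]]]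

/-- The dot product on `ℤ⁴`. -/
def intDot (x y : Fin 4 → ℤ) : ℤ := x 0 * y 0 + x 1 * y 1 + x 2 * y 2 + x 3 * y 3

/-- The `i`-th vertex of the 24-cell lies on the `j`-th facet. -/
abbrev cellIncident (i j : Fin 24) : Prop := intDot (cellNormal j) (cellVertex i) = 2

/-- The weight that distinguishes one of the three cross-polytopes formed by the vertices. -/
def vertexWeight (i : Fin 24) : ℤ :=
  3 * ((cellVertex i 0 * cellVertex i 1) ^ 2 + (cellVertex i 2 * cellVertex i 3) ^ 2) - 1

/-- The weight that distinguishes one of the three cross-polytopes formed by the normals. -/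
def normalWeight (j : Fin 24) : ℤ :=
  2 - 3 * (cellNormal j 0 * cellNormal j 1 * cellNormal j 2 * cellNormal j 3) ^ 2

/-- A self-stress of the 24-cell. -/
def cellStress (i j : Fin 24) : ℤ :=
  if cellIncident i j then vertexWeight i * normalWeight j else 0

theorem intDot_cellVertex_le : ∀ i k, intDot (cellVertex i) (cellVertex k) ≤ 2 := by
  decide +kernel

theorem intDot_cellVertex_self : ∀ i, intDot (cellVertex i) (cellVertex i) = 2 := by
  decide +kernel

theorem eq_of_intDot_cellVertex_eq_two :
    ∀ i k, intDot (cellVertex i) (cellVertex k) = 2 → k = i := by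
  decide +kernel

theorem intDot_cellNormal_cellVertex_le :
    ∀ j i, intDot (cellNormal j) (cellVertex i) ≤ 2 := by
  decide +kernel

theorem exists_cellIncident : ∀ j, ∃ i, cellIncident i j := by
  decide +kernel

theorem cellVertex_injective : ∀ i k, cellVertex i = cellVertex k → i = k := by
  decide +kernel

theorem cellNormal_injective : ∀ i k, cellNormal i = cellNormal k → i = k := by
  decide +kernel

/-- Together with `sum_cellVertex`, this allows a vector to be recovered from its inner products
with the vertices of one facet. -/
theorem sum_cellVertex_mul_cellVertex : ∀ j k l,
    ∑ i, (if cellIncident i j then cellVertex i k * cellVertex i l else 0) =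
      (if k = l then 2 else 0) + cellNormal j k * cellNormal j l := by
  decide +kernel

theorem sum_cellVertex : ∀ j k,
    ∑ i, (if cellIncident i j then cellVertex i k else 0) = 3 * cellNormal j k := by
  decide +kernel

theorem cellIncident_cellOctahedron : ∀ j r s, cellIncident (cellOctahedron j r s) j := by
  decide +kernel

theorem intDot_cellOctahedron : ∀ j r r' s s', r ≠ r' →
    intDot (cellVertex (cellOctahedron j r s)) (cellVertex (cellOctahedron j r' s')) = 1 := by
  decide +kernel

theorem cellOctahedron_ne : ∀ j r, cellOctahedron j r 0 ≠ cellOctahedron j r 1 := by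
  decide +kernel

/-- The functional given by the sum of two adjacent vertices exposes the edge between them; its
maximum is `2 + 1 = 3`. -/
theorem intDot_edge_le : ∀ i k, intDot (cellVertex i) (cellVertex k) = 1 → ∀ l,
    intDot (cellVertex i) (cellVertex l) + intDot (cellVertex k) (cellVertex l) ≤ 3 := by
  decide +kernel

theorem intDot_edge_eq_iff : ∀ i k, intDot (cellVertex i) (cellVertex k) = 1 → ∀ l,
    (intDot (cellVertex i) (cellVertex l) + intDot (cellVertex k) (cellVertex l) = 3 ↔
      l = i ∨ l = k) := by
  decide +kernel

/-- The octahedral facet has one pair of opposite vertices in each of the three cross-polytopes, all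
three pairs with the same sum, and the weights `2, -1, -1` cancel. The dual statement holds
likewise: each vertex lies on two facets from each cross-polytope of normals, and the three pairs of
normals have equal sums. -/
theorem sum_cellStress_mul_cellVertex :
    ∀ j k, ∑ i, cellStress i j * cellVertex i k = 0 := by
  decide +kernel

theorem sum_cellStress_mul_cellNormal :
    ∀ i k, ∑ j, cellStress i j * cellNormal j k = 0 := by
  decide +kernel

/-- The positive parts in two directions pair nontrivially under the stress. -/
theorem sum_cellStress_mul_posPart :
    ∑ i, ∑ j, cellStress i j *
      (2 * (max (intDot ![1, 0, 0, 0] (cellNormal j)) 0 *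
          max (intDot ![1, 0, 0, 0] (cellVertex i)) 0) +
        max (intDot ![1, 0, 0, 0] (cellNormal j)) 0 *
          max (intDot ![1, 1, 0, 0] (cellVertex i)) 0 +
        max (intDot ![1, 1, 0, 0] (cellNormal j)) 0 *
          max (intDot ![1, 0, 0, 0] (cellVertex i)) 0 +
        max (intDot ![1, 1, 0, 0] (cellNormal j)) 0 *
          max (intDot ![1, 1, 0, 0] (cellVertex i)) 0) = 16 := by
  decide +kernel

/-- No facet meets both open sides of the hyperplane orthogonal to `n`, except for the facets
parallel to `n`. -/
def IsCellCut (n : Fin 4 → ℤ) : Prop :=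
  ∀ i j, cellIncident i j →
    max (intDot n (cellVertex i)) 0 * intDot n (cellNormal j) =
        max (intDot n (cellVertex i)) 0 * max (intDot n (cellNormal j)) 0 ∧
      max (intDot n (cellNormal j)) 0 * intDot n (cellVertex i) =
        max (intDot n (cellVertex i)) 0 * max (intDot n (cellNormal j)) 0

theorem isCellCut_axis : IsCellCut ![1, 0, 0, 0] := by
  unfold IsCellCut
  decide +kernel

theorem isCellCut_root : IsCellCut ![1, 1, 0, 0] := by
  unfold IsCellCut
  decide +kernel

/-! ### The standard 24-cell in Euclidean space -/

/-- An integer vector as a point of Euclidean space. -/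
noncomputable def intVec (x : Fin 4 → ℤ) : EucSp 4 := WithLp.toLp 2 fun k => (x k : ℝ)

@[simp]
theorem intVec_apply (x : Fin 4 → ℤ) (k : Fin 4) : intVec x k = x k := rfl

@[simp]
theorem inner_intVec (x y : Fin 4 → ℤ) : inner ℝ (intVec x) (intVec y) = (intDot x y : ℝ) := by
  simp [PiLp.inner_apply, Fin.sum_univ_four, intVec, intDot]
  ring

/-- The `i`-th vertex of the 24-cell as a point of Euclidean space. -/
noncomputable def stdVertex (i : Fin 24) : EucSp 4 := intVec (cellVertex i)

/-- The normal vector of the `j`-th facet of the 24-cell. -/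
noncomputable def stdNormal (j : Fin 24) : EucSp 4 := (2⁻¹ : ℝ) • intVec (cellNormal j)

theorem inner_stdVertex (i k : Fin 24) :
    inner ℝ (stdVertex i) (stdVertex k) = (intDot (cellVertex i) (cellVertex k) : ℝ) :=
  inner_intVec _ _

theorem inner_stdNormal_stdVertex (i j : Fin 24) :
    inner ℝ (stdNormal j) (stdVertex i) = (intDot (cellNormal j) (cellVertex i) : ℝ) / 2 := by
  rw [stdNormal, stdVertex, real_inner_smul_left, inner_intVec]
  ring

theorem inner_stdNormal_stdVertex_eq_one_iff (i j : Fin 24) :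
    inner ℝ (stdNormal j) (stdVertex i) = (1 : ℝ) ↔ cellIncident i j := by
  rw [inner_stdNormal_stdVertex, div_eq_one_iff_eq (by norm_num)]
  exact_mod_cast Iff.rfl

theorem inner_stdNormal_stdVertex_le (i j : Fin 24) :
    inner ℝ (stdNormal j) (stdVertex i) ≤ (1 : ℝ) := by
  rw [inner_stdNormal_stdVertex, div_le_one (by norm_num)]
  exact_mod_cast intDot_cellNormal_cellVertex_le j i

theorem stdVertex_injective : Function.Injective stdVertex := by
  intro i k hik
  refine cellVertex_injective i k (funext fun l => ?_)
  have := congrArg (fun x : EucSp 4 => x l) hik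
  simpa [stdVertex] using this

theorem stdNormal_injective : Function.Injective stdNormal := by
  intro i k hik
  refine cellNormal_injective i k (funext fun l => ?_)
  have := congrArg (fun x : EucSp 4 => x l) hik
  simpa [stdNormal] using this

theorem inner_stdVertex_right (x : EucSp 4) (i : Fin 24) :
    inner ℝ x (stdVertex i) = ∑ l, (cellVertex i l : ℝ) * x l := by
  simp [PiLp.inner_apply, stdVertex]

/-- A facet of the 24-cell linearly spans the space. -/
theorem eq_smul_stdNormal {x : EucSp 4} {c : ℝ} {j : Fin 24}
    (h : ∀ i, cellIncident i j → inner ℝ x (stdVertex i) = c) : x = c • stdNormal j := by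
  have key : ∃ b : ℝ, x = b • stdNormal j := by
    -- With `N = cellNormal j`, the sum `∑ ⟪x, v⟫ v` over the vertices of the facet equals both `3 c
    -- N` and `2 x + ⟪N, x⟫ N`; solving for `x` gives this multiple of `N / 2`.
    refine ⟨3 * c - ∑ l, (cellNormal j l : ℝ) * x l, ?_⟩
    ext k
    have h1 : ∑ i, (if cellIncident i j then (cellVertex i k : ℝ) else 0) *
        inner ℝ x (stdVertex i) = 3 * c * cellNormal j k := by
      have h3 : ∑ i, (if cellIncident i j then (cellVertex i k : ℝ) else 0) =
          3 * cellNormal j k := by exact_mod_cast sum_cellVertex j k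
      rw [mul_right_comm, ← h3, Finset.sum_mul]
      refine Finset.sum_congr rfl fun i _ => ?_
      split_ifs with hi
      · rw [h i hi]
      · simp
    have h2 : ∑ i, (if cellIncident i j then (cellVertex i k : ℝ) else 0) *
        inner ℝ x (stdVertex i) = 2 * x k + cellNormal j k * ∑ l, (cellNormal j l : ℝ) * x l := by
      have h3 : ∀ l, ∑ i, (if cellIncident i j then (cellVertex i k : ℝ) * cellVertex i l else 0) =
          (if k = l then 2 else 0) + (cellNormal j k : ℝ) * cellNormal j l := fun l => by
        exact_mod_cast sum_cellVertex_mul_cellVertex j k l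
      calc _ = ∑ l, (∑ i, (if cellIncident i j then
            (cellVertex i k : ℝ) * cellVertex i l else 0)) * x l := by
            simp_rw [inner_stdVertex_right, Finset.mul_sum, Finset.sum_mul]
            rw [Finset.sum_comm]
            refine Finset.sum_congr rfl fun l _ => Finset.sum_congr rfl fun i _ => ?_
            split_ifs <;> ring
        _ = _ := by
            simp_rw [h3, add_mul, Finset.sum_add_distrib, Finset.mul_sum, mul_assoc]
            simp
    simp only [stdNormal, PiLp.smul_apply, intVec_apply, smul_eq_mul]
    linarith
  obtain ⟨b, rfl⟩ := key
  obtain ⟨i, hi⟩ := exists_cellIncident j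
  have := h i hi
  rw [real_inner_smul_left, (inner_stdNormal_stdVertex_eq_one_iff i j).2 hi, mul_one] at this
  rw [this]

theorem twentyFourCell_eq : twentyFourCell = convexHull ℝ (Set.range stdVertex) := by
  have key : {x : EucSp 4 | ∃ i j : Fin 4, i < j ∧ ∃ s t : ℝ, (s = 1 ∨ s = -1) ∧
      (t = 1 ∨ t = -1) ∧ x = EuclideanSpace.single i s + EuclideanSpace.single j t} =
      Set.range stdVertex := by
    have h1 : ∀ i j : Fin 4, i < j → ∀ s ∈ ({1, -1} : Finset ℤ), ∀ t ∈ ({1, -1} : Finset ℤ),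
        ∃ k, cellVertex k = Pi.single i s + Pi.single j t := by
      decide +kernel
    have h2 : ∀ k, ∃ i j : Fin 4, i < j ∧ ∃ s ∈ ({1, -1} : Finset ℤ),
        ∃ t ∈ ({1, -1} : Finset ℤ), cellVertex k = Pi.single i s + Pi.single j t := by
      decide +kernel
    have h3 : ∀ (i j : Fin 4) (s t : ℤ), intVec (Pi.single i s + Pi.single j t) =
        EuclideanSpace.single i (s : ℝ) + EuclideanSpace.single j (t : ℝ) := by
      intro i j s t
      ext k
      simp [Pi.single_apply]
    ext x
    constructor
    · rintro ⟨i, j, hij, s, t, hs, ht, rfl⟩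
      have hs' : ∃ s' ∈ ({1, -1} : Finset ℤ), (s' : ℝ) = s := by
        rcases hs with rfl | rfl
        · exact ⟨1, by simp, by simp⟩
        · exact ⟨-1, by simp, by simp⟩
      have ht' : ∃ t' ∈ ({1, -1} : Finset ℤ), (t' : ℝ) = t := by
        rcases ht with rfl | rfl
        · exact ⟨1, by simp, by simp⟩
        · exact ⟨-1, by simp, by simp⟩
      obtain ⟨s', hs', rfl⟩ := hs'
      obtain ⟨t', ht', rfl⟩ := ht'
      obtain ⟨k, hk⟩ := h1 i j hij s' hs' t' ht'
      exact ⟨k, by rw [stdVertex, hk, h3]⟩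
    · rintro ⟨k, rfl⟩
      obtain ⟨i, j, hij, s, hs, t, ht, hk⟩ := h2 k
      refine ⟨i, j, hij, s, t, ?_, ?_, by rw [stdVertex, hk, h3]⟩
      · have : s = 1 ∨ s = -1 := by simpa using hs
        exact_mod_cast this
      · have : t = 1 ∨ t = -1 := by simpa using ht
        exact_mod_cast this
  rw [twentyFourCell, key]

theorem stdVertex_mem (i : Fin 24) : stdVertex i ∈ twentyFourCell := by
  rw [twentyFourCell_eq]
  exact subset_convexHull ℝ _ (Set.mem_range_self i)

theorem inner_le_of_mem_twentyFourCell {a x : EucSp 4} {c : ℝ} (hx : x ∈ twentyFourCell)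
    (h : ∀ i, inner ℝ a (stdVertex i) ≤ c) : inner ℝ a x ≤ c := by
  rw [twentyFourCell_eq] at hx
  have : convexHull ℝ (Set.range stdVertex) ⊆ {x | inner ℝ a x ≤ c} := by
    refine convexHull_min ?_ (convex_halfSpace_le (innerSL ℝ a).toLinearMap.isLinear c)
    rintro _ ⟨i, rfl⟩
    exact h i
  exact this hx

/-- A linear inequality that is tight at some vertex defines a face of the 24-cell. -/
theorem isExposed_twentyFourCell {a : EucSp 4} {c : ℝ} (h : ∀ i, inner ℝ a (stdVertex i) ≤ c) :
    IsExposed ℝ twentyFourCell {x ∈ twentyFourCell | inner ℝ a x = c} := by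
  rintro ⟨x₀, hx₀, hx₀c⟩
  refine ⟨innerSL ℝ a, Set.ext fun x => and_congr_right fun hx => ⟨fun hxc y hy => ?_, fun hm => ?_⟩⟩
  · simp only [innerSL_apply_apply]
    exact (inner_le_of_mem_twentyFourCell hy h).trans hxc.ge
  · refine le_antisymm (inner_le_of_mem_twentyFourCell hx h) ?_
    have := hm x₀ hx₀
    simp only [innerSL_apply_apply] at this
    exact hx₀c.ge.trans this

theorem eq_convexHull_of_isExposed_twentyFourCell {F : Set (EucSp 4)}
    (hF : IsExposed ℝ twentyFourCell F) : F = convexHull ℝ (stdVertex '' {i | stdVertex i ∈ F}) := by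
  rw [twentyFourCell_eq] at hF
  exact isExposed_eq_convexHull hF

theorem isExposed_singleton_stdVertex (i : Fin 24) :
    IsExposed ℝ twentyFourCell {stdVertex i} := by
  have hle : ∀ k, inner ℝ (stdVertex i) (stdVertex k) ≤ (2 : ℝ) := fun k => by
    rw [inner_stdVertex]
    exact_mod_cast intDot_cellVertex_le i k
  have h := isExposed_twentyFourCell hle
  have h2 := eq_convexHull_of_isExposed_twentyFourCell h
  have h3 : {k | stdVertex k ∈ {x ∈ twentyFourCell | inner ℝ (stdVertex i) x = (2 : ℝ)}} = {i} := by
    ext k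
    simp only [Set.mem_ofPred_eq, stdVertex_mem, true_and, inner_stdVertex, Set.mem_singleton_iff]
    constructor
    · intro hk
      exact eq_of_intDot_cellVertex_eq_two i k (by exact_mod_cast hk)
    · rintro rfl
      exact_mod_cast intDot_cellVertex_self k
  rw [h3, Set.image_singleton, convexHull_singleton] at h2
  rwa [h2] at h

/-- The `j`-th facet of the 24-cell. -/
def stdFacet (j : Fin 24) : Set (EucSp 4) :=
  {x ∈ twentyFourCell | inner ℝ (stdNormal j) x = 1}

theorem stdVertex_mem_stdFacet (i j : Fin 24) : stdVertex i ∈ stdFacet j ↔ cellIncident i j := by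
  simp [stdFacet, stdVertex_mem, inner_stdNormal_stdVertex_eq_one_iff]

theorem isFacet_stdFacet (j : Fin 24) : IsFacet twentyFourCell (stdFacet j) := by
  obtain ⟨i₀, hi₀⟩ := exists_cellIncident j
  have hi₀F := (stdVertex_mem_stdFacet i₀ j).2 hi₀
  refine ⟨isExposed_twentyFourCell fun i => inner_stdNormal_stdVertex_le i j, ⟨_, hi₀F⟩, ?_⟩
  have hne : stdNormal j ≠ 0 := ne_zero_of_inner_eq_one hi₀F.2
  have key : vectorSpan ℝ (stdFacet j) = (Submodule.span ℝ {stdNormal j})ᗮ := by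
    rw [← Submodule.orthogonal_orthogonal (vectorSpan ℝ (stdFacet j))]
    congr 1
    apply le_antisymm
    -- A vector orthogonal to all directions of the facet is constant on its vertices, so
    -- `eq_smul_stdNormal` applies.
    · intro x hx
      rw [Submodule.mem_orthogonal'] at hx
      rw [eq_smul_stdNormal (x := x) (j := j) (c := inner ℝ x (stdVertex i₀)) fun i hi => ?_]
      · exact Submodule.smul_mem _ _ (Submodule.mem_span_singleton_self _)
      · have := hx _ (vsub_mem_vectorSpan ℝ ((stdVertex_mem_stdFacet i j).2 hi) hi₀F)
        rw [vsub_eq_sub, inner_sub_right] at this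
        linarith
    · rw [Submodule.span_singleton_le_iff_mem]
      exact mem_orthogonal_vectorSpan fun x hx => hx.2
  rw [key]
  exact finrank_orthogonal_span_singleton_add_one hne

theorem stdFacet_injective : Function.Injective stdFacet := by
  intro j k hjk
  obtain ⟨hexp, hne, hdim⟩ := isFacet_stdFacet j
  exact stdNormal_injective (eq_of_inner_eq_one_of_finrank hne hdim (fun x hx => hx.2)
    fun x hx => (hjk ▸ hx : x ∈ stdFacet k).2)

/-- A labeling of the 24-cell is a relabeling of the standard one. -/
theorem LabeledPolytope.exists_equiv_of_twentyFourCell (P : LabeledPolytope 4 24 24)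
    (hP : P.carrier = twentyFourCell) :
    ∃ σ τ : Fin 24 ≃ Fin 24, (∀ i, P.vertex (σ i) = stdVertex i) ∧
      ∀ j, P.facet (τ j) = stdFacet j := by
  have hv : ∀ i, ∃ k, P.vertex k = stdVertex i := fun i => by
    have : stdVertex i ∈ Set.range P.vertex := by
      rw [P.range_vertex, hP]
      exact isExposed_singleton_stdVertex i
    exact this
  have hf : ∀ j, ∃ k, P.facet k = stdFacet j := fun j => by
    have : stdFacet j ∈ Set.range P.facet := by
      rw [P.range_facet, hP]
      exact isFacet_stdFacet j
    exact this
  choose σ hσ using hv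
  choose τ hτ using hf
  have hσi : Function.Injective σ := fun i k hik => stdVertex_injective (by rw [← hσ, hik, hσ])
  have hτi : Function.Injective τ := fun i k hik => stdFacet_injective (by rw [← hτ, hik, hτ])
  exact ⟨Equiv.ofBijective σ (Finite.injective_iff_bijective.1 hσi),
    Equiv.ofBijective τ (Finite.injective_iff_bijective.1 hτi), hσ, hτ⟩

/-! ### Regular realizations of the 24-cell are affine images of the standard one -/

theorem left_mem_extremePoints_segment {E : Type*} [NormedAddCommGroup E] [NormedSpace ℝ E]
    {x y : E} (hxy : x ≠ y) : x ∈ (segment ℝ x y).extremePoints ℝ := by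
  rw [mem_extremePoints_iff_left]
  refine ⟨left_mem_segment ℝ x y, ?_⟩
  intro u hu v hv hx
  rw [segment_eq_image_lineMap] at hu hv
  rw [openSegment_eq_image_lineMap] at hx
  obtain ⟨a, ha, rfl⟩ := hu
  obtain ⟨b, hb, rfl⟩ := hv
  obtain ⟨c, hc, hx⟩ := hx
  simp only [AffineMap.lineMap_apply_module'] at hx ⊢
  have h1 : (a + c * (b - a)) • (y - x) = 0 := by
    rw [← sub_eq_zero] at hx
    rw [← hx]
    module
  have h2 := (smul_eq_zero.1 h1).resolve_right (sub_ne_zero.2 hxy.symm)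
  have h3 : a = 0 := by nlinarith [ha.1, hb.1, hc.1, hc.2, mul_nonneg hc.1.le hb.1]
  simp [h3]

theorem right_mem_extremePoints_segment {E : Type*} [NormedAddCommGroup E] [NormedSpace ℝ E]
    {x y : E} (hxy : x ≠ y) : y ∈ (segment ℝ x y).extremePoints ℝ := by
  rw [segment_symm]
  exact left_mem_extremePoints_segment hxy.symm

/-- The endpoints of the smaller face are extreme in `K`, so inside the larger segment they can only
be its endpoints. -/
theorem dist_eq_of_segment_subset {d : ℕ} {K : Set (EucSp d)} {x y x' y' : EucSp d} (hxy : x ≠ y)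
    (h : IsExposed ℝ K (segment ℝ x y)) (h' : IsExposed ℝ K (segment ℝ x' y'))
    (hsub : segment ℝ x y ⊆ segment ℝ x' y') : dist x y = dist x' y' := by
  have key : ∀ w ∈ (segment ℝ x y).extremePoints ℝ, w = x' ∨ w = y' := by
    intro w hw
    have hwK : w ∈ K.extremePoints ℝ := h.isExtreme.extremePoints_subset_extremePoints hw
    have := (mem_extremePoints_iff_forall_segment.1 hwK).2 x' (h'.subset (left_mem_segment ℝ _ _))
      y' (h'.subset (right_mem_segment ℝ _ _)) (hsub hw.1)
    tauto
  rcases key x (left_mem_extremePoints_segment hxy) with rfl | rfl <;>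
    rcases key y (right_mem_extremePoints_segment hxy) with rfl | rfl
  · exact absurd rfl hxy
  · rfl
  · exact dist_comm _ _
  · exact absurd rfl hxy

/-- All edges of a regular polytope have the same length. -/
theorem IsRegularPolytope.dist_eq {d : ℕ} {K : Set (EucSp d)} (hK : IsRegularPolytope K)
    {x y x' y' : EucSp d} (hxy : x ≠ y) (hxy' : x' ≠ y')
    (h : IsExposed ℝ K (segment ℝ x y)) (h' : IsExposed ℝ K (segment ℝ x' y')) :
    dist x y = dist x' y' := by
  obtain ⟨c, hc⟩ := Flag.exists_mem (⟨_, h⟩ : FaceLattice K)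
  obtain ⟨c', hc'⟩ := Flag.exists_mem (⟨_, h'⟩ : FaceLattice K)
  obtain ⟨σ, -, hσ⟩ := hK c c'
  obtain ⟨G, hG, hGσ⟩ := hσ _ hc
  have hGs : (G : Set (EucSp d)) = segment ℝ (σ x) (σ y) := by
    rw [hGσ]
    exact image_segment ℝ σ.toAffineEquiv.toAffineMap x y
  have hGe := G.2
  rw [hGs] at hGe
  rw [← σ.dist_map]
  -- The moved edge and the target edge lie in one flag, hence are nested; no rank argument is
  -- needed, since nested edges have equal length.
  rcases c'.le_or_le hG hc' with hle | hle
  · have hle : (G : Set (EucSp d)) ⊆ segment ℝ x' y' := hle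
    exact dist_eq_of_segment_subset (σ.injective.ne hxy) hGe h' (hGs ▸ hle)
  · have hle : segment ℝ x' y' ⊆ (G : Set (EucSp d)) := hle
    exact (dist_eq_of_segment_subset hxy' h' hGe (hGs ▸ hle)).symm

/-- An octahedron in a hyperplane of four-space, all of whose edges are equally long, is centrally
symmetric. -/
theorem add_eq_add_of_dist_eq {f : Fin 3 → Fin 2 → EucSp 4} {a : EucSp 4} {D : ℝ}
    (ha : ∀ r s, inner ℝ a (f r s) = 1)
    (hD : ∀ r r' s s', r ≠ r' → dist (f r s) (f r' s') = D) (hne : ∀ r, f r 0 ≠ f r 1)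
    (r r' : Fin 3) : f r 0 + f r 1 = f r' 0 + f r' 1 := by
  set u : Fin 3 → EucSp 4 := fun t => f t 0 - f t 1 with hu
  set x := f r 0 + f r 1 - (f r' 0 + f r' 1) with hx
  -- A vertex off the diagonal `u t` is equidistant from both its ends, which fixes its inner
  -- product with `u t`.
  have hfu : ∀ t r s, r ≠ t → 2 * inner ℝ (f r s) (u t) = ‖f t 0‖ ^ 2 - ‖f t 1‖ ^ 2 := by
    intro t r s hrt
    have h0 := hD r t s 0 hrt
    have h1 := hD r t s 1 hrt
    rw [dist_eq_norm] at h0 h1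
    have e0 := norm_sub_sq_real (f r s) (f t 0)
    have e1 := norm_sub_sq_real (f r s) (f t 1)
    rw [h0] at e0
    rw [h1] at e1
    rw [hu]
    simp only [inner_sub_right]
    linarith
  have hsum : ∀ r t, inner ℝ (f r 0 + f r 1) (u t) = ‖f t 0‖ ^ 2 - ‖f t 1‖ ^ 2 := by
    intro r t
    by_cases hrt : r = t
    · subst hrt
      simp only [hu, inner_sub_right, inner_add_left, real_inner_self_eq_norm_sq,
        real_inner_comm (f r 1) (f r 0)]
      ring
    · rw [inner_add_left]
      linarith [hfu t r 0 hrt, hfu t r 1 hrt]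
  have hxu : ∀ t, inner ℝ x (u t) = 0 := fun t => by
    rw [hx, inner_sub_left, hsum, hsum, sub_self]
  have hau : ∀ t, inner ℝ a (u t) = 0 := fun t => by
    simp only [hu, inner_sub_right, ha, sub_self]
  have hax : inner ℝ a x = 0 := by
    rw [hx]
    simp only [inner_sub_right, inner_add_right, ha, sub_self]
  have huu : ∀ t t', t ≠ t' → inner ℝ (u t) (u t') = 0 := fun t t' htt => by
    have e0 := hfu t' t 0 htt
    have e1 := hfu t' t 1 htt
    rw [show u t = f t 0 - f t 1 from rfl, inner_sub_left]
    linarith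
  by_contra hne'
  have hx0 : x ≠ 0 := sub_ne_zero.2 hne'
  -- If the two pair sums differed, these would be five nonzero pairwise orthogonal vectors in a
  -- four-dimensional space.
  have hli : LinearIndependent ℝ ![x, a, u 0, u 1, u 2] := by
    refine linearIndependent_of_ne_zero_of_inner_eq_zero (𝕜 := ℝ) ?_ ?_
    · intro i
      fin_cases i
      · exact hx0
      · exact ne_zero_of_inner_eq_one (ha 0 0)
      · exact sub_ne_zero.2 (hne 0)
      · exact sub_ne_zero.2 (hne 1)
      · exact sub_ne_zero.2 (hne 2)
    · have hxu' : ∀ t, inner ℝ (u t) x = 0 := fun t => (real_inner_comm _ _).trans (hxu t)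
      have hau' : ∀ t, inner ℝ (u t) a = 0 := fun t => (real_inner_comm _ _).trans (hau t)
      have hax' : inner ℝ x a = 0 := (real_inner_comm _ _).trans hax
      intro i j hij
      fin_cases i <;> fin_cases j <;> first
        | exact absurd rfl hij
        | simp [hxu, hau, hax, hxu', hau', hax', huu]
  have := hli.fintype_card_le_finrank
  simp at this

/-- The relations between the vertices of the octahedral facets determine the 24-cell up to affine
maps, in each coordinate. -/
theorem exists_coefficients_of_cellOctahedron {w : Fin 24 → ℝ}
    (H : ∀ j r r', w (cellOctahedron j r 0) + w (cellOctahedron j r 1) =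
      w (cellOctahedron j r' 0) + w (cellOctahedron j r' 1)) :
    ∃ (m : Fin 4 → ℝ) (t : ℝ), ∀ i, w i = ∑ k, (cellVertex i k : ℝ) * m k + t := by
  have e0 : w 0 + w 1 = w 4 + w 5 := H 0 0 1
  have e1 : w 0 + w 1 = w 8 + w 9 := H 0 0 2
  have e2 : w 2 + w 3 = w 6 + w 7 := H 1 0 1
  have e3 : w 2 + w 3 = w 10 + w 11 := H 1 0 2
  have e4 : w 0 + w 2 = w 12 + w 13 := H 2 0 1
  have e5 : w 0 + w 2 = w 16 + w 17 := H 2 0 2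
  have e6 : w 1 + w 3 = w 14 + w 15 := H 3 0 1
  have e7 : w 1 + w 3 = w 18 + w 19 := H 3 0 2
  have e8 : w 4 + w 6 = w 12 + w 14 := H 4 0 1
  have e9 : w 4 + w 6 = w 20 + w 21 := H 4 0 2
  have e10 : w 5 + w 7 = w 22 + w 23 := H 5 0 2
  have e11 : w 8 + w 10 = w 16 + w 18 := H 6 0 1
  have e12 : w 8 + w 10 = w 20 + w 22 := H 6 0 2
  have e13 : w 0 + w 20 = w 4 + w 16 := H 8 0 1
  have e14 : w 0 + w 20 = w 8 + w 12 := H 8 0 2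
  have e15 : w 0 + w 21 = w 4 + w 17 := H 9 0 1
  have e16 : w 0 + w 21 = w 9 + w 12 := H 9 0 2
  have e17 : w 0 + w 22 = w 5 + w 16 := H 10 0 1
  have e18 : w 0 + w 23 = w 5 + w 17 := H 11 0 1
  -- The translation is the midpoint of the antipodal vertices `0` and `3`. The point `e_0` is the
  -- midpoint of vertices `0` and `1`, `e_1` is half their difference, and vertices `4` and `8` are
  -- `e_0 + e_2` and `e_0 + e_3`.
  refine ⟨![(w 0 + w 1) / 2 - (w 0 + w 3) / 2, (w 0 - w 1) / 2, w 4 - (w 0 + w 1) / 2,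
    w 8 - (w 0 + w 1) / 2], (w 0 + w 3) / 2, fun i => ?_⟩
  rw [Fin.sum_univ_four]
  fin_cases i <;> simp [cellVertex] <;> linarith

theorem exists_linearMap_of_cellOctahedron {W : Fin 24 → EucSp 4}
    (H : ∀ j r r', W (cellOctahedron j r 0) + W (cellOctahedron j r 1) =
      W (cellOctahedron j r' 0) + W (cellOctahedron j r' 1)) :
    ∃ (M : EucSp 4 →ₗ[ℝ] EucSp 4) (t : EucSp 4), ∀ i, W i = M (stdVertex i) + t := by
  have h : ∀ l : Fin 4, ∃ (m : Fin 4 → ℝ) (t : ℝ), ∀ i,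
      W i l = ∑ k, (cellVertex i k : ℝ) * m k + t := fun l =>
    exists_coefficients_of_cellOctahedron fun j r r' => by
      simpa using congrArg (fun x : EucSp 4 => x l) (H j r r')
  choose m t hmt using h
  refine ⟨Matrix.toLpLin 2 2 (Matrix.of m), WithLp.toLp 2 t, fun i => ?_⟩
  ext l
  rw [hmt]
  simp [Matrix.toLpLin_apply, Matrix.mulVec, dotProduct, stdVertex, mul_comm]

/-- A functional constant on the vertices is constant on `K`, a neighborhood of the origin. -/
theorem DoubleDescription.eq_zero_of_inner_const {d n m : ℕ} {K : Set (EucSp d)}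
    {V : Fin n → EucSp d} {A : Fin m → EucSp d} (h : DoubleDescription K V A) {b : EucSp d} {c : ℝ}
    (hb : ∀ i, inner ℝ b (V i) = c) : b = 0 := by
  have hK : K ⊆ {x | inner ℝ b x = c} := by
    rw [h.eq_convexHull]
    refine convexHull_min ?_ (convex_hyperplane (innerSL ℝ b).toLinearMap.isLinear c)
    rintro _ ⟨i, rfl⟩
    exact hb i
  have h0 : inner ℝ b (0 : EucSp d) = c := hK (mem_of_mem_nhds h.mem_nhds_zero)
  have hev : ∀ᶠ ε : ℝ in nhdsWithin 0 (Set.Ioi 0), ε • b ∈ K := by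
    have hcont : Continuous fun ε : ℝ => ε • b := by fun_prop
    have h1 : ∀ᶠ ε : ℝ in nhds 0, ε • b ∈ K :=
      hcont.continuousAt.eventually_mem (by simpa using h.mem_nhds_zero)
    exact h1.filter_mono nhdsWithin_le_nhds
  obtain ⟨ε, hε, hεpos⟩ := (hev.and self_mem_nhdsWithin).exists
  have hεpos : 0 < ε := hεpos
  have h1 : inner ℝ b (ε • b) = c := hK hε
  rw [← h0, inner_zero_right, inner_smul_right] at h1
  exact inner_self_eq_zero.1 ((mul_eq_zero.1 h1).resolve_left hεpos.ne')

namespace LabeledPolytope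

variable {P : LabeledPolytope 4 24 24} {p : (Fin 24 → EucSp 4) × (Fin 24 → EucSp 4)}
  {σ τ : Fin 24 ≃ Fin 24}

theorem inner_eq_one_iff_cellIncident (hσ : ∀ i, P.vertex (σ i) = stdVertex i)
    (hτ : ∀ j, P.facet (τ j) = stdFacet j) (hp : p ∈ P.centeredRealizationSpace) (i j : Fin 24) :
    inner ℝ (p.2 (τ j)) (p.1 (σ i)) = 1 ↔ cellIncident i j := by
  rw [P.inner_eq_one_iff hp, hσ, hτ, stdVertex_mem_stdFacet]

/-- The isomorphism of face lattices carries the edge of the 24-cell to a face with exactly two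
vertices, which is the segment between them. -/
theorem isExposed_segment (hP : P.carrier = twentyFourCell)
    (hσ : ∀ i, P.vertex (σ i) = stdVertex i) (hp : p ∈ P.centeredRealizationSpace)
    {i k : Fin 24} (hik : intDot (cellVertex i) (cellVertex k) = 1) :
    IsExposed ℝ (convexHull ℝ (Set.range p.1)) (segment ℝ (p.1 (σ i)) (p.1 (σ k))) := by
  obtain ⟨Q, hQc, hQh, hQv, -, e, hev, -⟩ := hp
  have hdd : DoubleDescription Q.carrier p.1 p.2 := ⟨hQc, hQh⟩
  have hinner : ∀ l, inner ℝ (stdVertex i + stdVertex k) (stdVertex l) =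
      ((intDot (cellVertex i) (cellVertex l) + intDot (cellVertex k) (cellVertex l) : ℤ) : ℝ) :=
    fun l => by
      rw [inner_add_left, inner_stdVertex, inner_stdVertex]
      push_cast
      ring
  have hE : IsExposed ℝ P.carrier
      {x ∈ P.carrier | inner ℝ (stdVertex i + stdVertex k) x = 3} := by
    rw [hP]
    refine isExposed_twentyFourCell fun l => ?_
    rw [hinner]
    exact_mod_cast intDot_edge_le i k hik l
  have hmem : ∀ l, p.1 (σ l) ∈ (e.symm ⟨_, hE⟩).1 ↔ l = i ∨ l = k := by
    intro l
    have h1 : p.1 (σ l) ∈ (e.symm ⟨_, hE⟩).1 ↔ Q.vertexFace (σ l) ≤ e.symm ⟨_, hE⟩ := by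
      rw [← hQv]
      exact (Set.singleton_subset_iff (s := (e.symm ⟨_, hE⟩).1)).symm
    have h2 : P.vertexFace (σ l) ≤ (⟨_, hE⟩ : FaceLattice P.carrier) ↔
        P.vertex (σ l) ∈ {x ∈ P.carrier | inner ℝ (stdVertex i + stdVertex k) x = 3} :=
      Set.singleton_subset_iff
    rw [h1, e.le_symm_apply, hev, h2, hσ, hP]
    simp only [Set.mem_ofPred_eq, stdVertex_mem, true_and, hinner]
    rw [← intDot_edge_eq_iff i k hik l]
    exact_mod_cast Iff.rfl
  have hset : {l | p.1 l ∈ (e.symm ⟨_, hE⟩).1} = {σ i, σ k} := by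
    ext l
    obtain ⟨l, rfl⟩ := σ.surjective l
    simpa using hmem l
  have hF := (e.symm ⟨_, hE⟩).2
  have hFeq := hdd.face_eq_convexHull hF
  rw [hset, Set.image_pair, convexHull_pair] at hFeq
  rw [hFeq, hQc] at hF
  exact hF

/-- A regular realization of the 24-cell is an affine image of the standard 24-cell. -/
theorem exists_continuousLinearEquiv (hP : P.carrier = twentyFourCell)
    (hσ : ∀ i, P.vertex (σ i) = stdVertex i) (hτ : ∀ j, P.facet (τ j) = stdFacet j)
    (hp : p ∈ P.centeredRealizationSpace)
    (hreg : IsRegularPolytope (convexHull ℝ (Set.range p.1))) :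
    ∃ (M : EucSp 4 ≃L[ℝ] EucSp 4) (t : EucSp 4), ∀ i, p.1 (σ i) = M (stdVertex i) + t := by
  obtain ⟨K, hdd⟩ := P.exists_doubleDescription hp
  have hinj : Function.Injective p.1 := by
    obtain ⟨Q, -, -, hQv, -⟩ := hp
    intro i k hik
    exact Q.vertex_injective (by rw [hQv, hQv, hik])
  have hne : ∀ {i k}, intDot (cellVertex i) (cellVertex k) = 1 → p.1 (σ i) ≠ p.1 (σ k) := by
    intro i k hik h
    have := σ.injective (hinj h)
    subst this
    rw [intDot_cellVertex_self] at hik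
    norm_num at hik
  obtain ⟨D, hD⟩ : ∃ D, ∀ i k, intDot (cellVertex i) (cellVertex k) = 1 →
      dist (p.1 (σ i)) (p.1 (σ k)) = D := by
    have h01 : intDot (cellVertex 0) (cellVertex 4) = 1 := by decide +kernel
    exact ⟨_, fun i k hik => hreg.dist_eq (hne hik) (hne h01) (isExposed_segment hP hσ hp hik)
      (isExposed_segment hP hσ hp h01)⟩
  obtain ⟨M, t, hM⟩ := exists_linearMap_of_cellOctahedron (W := fun i => p.1 (σ i))
    fun j r r' => add_eq_add_of_dist_eq (f := fun r s => p.1 (σ (cellOctahedron j r s)))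
      (a := p.2 (τ j)) (D := D)
      (fun r s => (inner_eq_one_iff_cellIncident hσ hτ hp _ _).2 (cellIncident_cellOctahedron j r s))
      (fun r r' s s' hrr => hD _ _ (intDot_cellOctahedron j r r' s s' hrr))
      (fun r h => cellOctahedron_ne j r (σ.injective (hinj h))) r r'
  -- A vector orthogonal to the range of `M` would be constant on all vertices.
  have hsurj : Function.Surjective M := by
    rw [← LinearMap.range_eq_top, ← Submodule.orthogonal_eq_bot_iff, Submodule.eq_bot_iff]
    intro b hb
    refine hdd.eq_zero_of_inner_const (c := inner ℝ b t) fun i => ?_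
    obtain ⟨i, rfl⟩ := σ.surjective i
    rw [hM, inner_add_right,
      Submodule.inner_left_of_mem_orthogonal (LinearMap.mem_range_self M _) hb, zero_add]
  have hbij : Function.Bijective M := ⟨LinearMap.injective_iff_surjective.2 hsurj, hsurj⟩
  exact ⟨(LinearEquiv.ofBijective M hbij).toContinuousLinearEquiv, t, hM⟩

end LabeledPolytope

/-! ### Second-order obstruction at the standard 24-cell -/

theorem sum_cellStress_smul_stdVertex (j : Fin 24) :
    ∑ i, (cellStress i j : ℝ) • stdVertex i = 0 := by
  ext k
  have h : ∑ i, (cellStress i j : ℝ) * cellVertex i k = 0 := by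
    exact_mod_cast sum_cellStress_mul_cellVertex j k
  simpa [stdVertex] using h

theorem sum_cellStress_smul_stdNormal (i : Fin 24) :
    ∑ j, (cellStress i j : ℝ) • stdNormal j = 0 := by
  ext k
  have h : ∑ j, (cellStress i j : ℝ) * cellNormal j k = 0 := by
    exact_mod_cast sum_cellStress_mul_cellNormal i k
  have h2 : ∑ j, (cellStress i j : ℝ) * (2⁻¹ * cellNormal j k) = 0 := by
    simp_rw [mul_left_comm _ (2⁻¹ : ℝ)]
    rw [← Finset.mul_sum, h, mul_zero]
  simpa [stdNormal] using h2

/-- The velocity of a curve of realizations is isotropic for the quadratic form of the stress. -/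
theorem sum_cellStress_mul_inner_deriv_eq_zero {v a : Fin 24 → ℝ → EucSp 4}
    (hv : ∀ i, ContDiffAt ℝ 2 (v i) 0) (ha : ∀ j, ContDiffAt ℝ 2 (a j) 0)
    (hv0 : ∀ i, v i 0 = stdVertex i) (ha0 : ∀ j, a j 0 = stdNormal j)
    (h : ∀ i j, cellIncident i j → ∀ᶠ s in nhds 0, inner ℝ (a j s) (v i s) = (1 : ℝ)) :
    ∑ i, ∑ j, (cellStress i j : ℝ) * inner ℝ (deriv (a j) 0) (deriv (v i) 0) = 0 := by
  -- The second-order condition is solved for the velocity term. The remaining terms pair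
  -- accelerations with weighted sums of normals or vertices, which vanish by the stress conditions.
  have key : ∀ i j, (cellStress i j : ℝ) * inner ℝ (deriv (a j) 0) (deriv (v i) 0) =
      -(2⁻¹ * ((cellStress i j : ℝ) * inner ℝ (stdNormal j) (deriv (deriv (v i)) 0))) +
      -(2⁻¹ * ((cellStress i j : ℝ) * inner ℝ (deriv (deriv (a j)) 0) (stdVertex i))) := by
    intro i j
    by_cases hij : cellIncident i j
    · have := inner_second_order (hv i) (ha j) (h i j hij)
      rw [hv0, ha0] at this
      linear_combination (cellStress i j : ℝ) / 2 * this
    · simp [cellStress, hij]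
  have h1 : ∑ i, ∑ j, (cellStress i j : ℝ) * inner ℝ (stdNormal j) (deriv (deriv (v i)) 0) = 0 := by
    refine Finset.sum_eq_zero fun i _ => ?_
    have := congrArg (fun x => inner ℝ x (deriv (deriv (v i)) 0)) (sum_cellStress_smul_stdNormal i)
    simpa only [sum_inner, real_inner_smul_left, inner_zero_left] using this
  have h2 : ∑ i, ∑ j, (cellStress i j : ℝ) * inner ℝ (deriv (deriv (a j)) 0) (stdVertex i) = 0 := by
    rw [Finset.sum_comm]
    refine Finset.sum_eq_zero fun j _ => ?_
    have := congrArg (fun x => inner ℝ (deriv (deriv (a j)) 0) x) (sum_cellStress_smul_stdVertex j)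
    simpa only [inner_sum, real_inner_smul_right, inner_zero_right] using this
  simp_rw [key, Finset.sum_add_distrib, Finset.sum_neg_distrib, ← Finset.mul_sum, h1, h2]
  simp

/-! ### Stretching half of the 24-cell -/

/-- The velocity of the `i`-th vertex when the halfspace `⟪n, x⟫ ≥ 0` is stretched along `n`. -/
noncomputable def vertexStretch (n : Fin 4 → ℤ) (i : Fin 24) : EucSp 4 :=
  ((max (intDot n (cellVertex i)) 0 : ℤ) / (intDot n n : ℝ)) • intVec n

/-- Minus the velocity of the `j`-th normal when the halfspace `⟪n, x⟫ ≥ 0` is stretched. -/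
noncomputable def normalStretch (n : Fin 4 → ℤ) (j : Fin 24) : EucSp 4 :=
  ((max (intDot n (cellNormal j)) 0 : ℤ) / (2 * intDot n n : ℝ)) • intVec n

/-- The 24-cell with the halfspace `⟪n, x⟫ ≥ 0` stretched along `n` by the factor `1 + s`. -/
noncomputable def stretchCurve (n : Fin 4 → ℤ) (s : ℝ) :
    (Fin 24 → EucSp 4) × (Fin 24 → EucSp 4) :=
  (fun i => stdVertex i + s • vertexStretch n i,
    fun j => stdNormal j - (s * (1 + s)⁻¹) • normalStretch n j)

theorem stretchCurve_zero (n : Fin 4 → ℤ) : stretchCurve n 0 = (stdVertex, stdNormal) := by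
  simp [stretchCurve]

theorem hasDerivAt_stretchCurve (n : Fin 4 → ℤ) :
    HasDerivAt (stretchCurve n) (vertexStretch n, fun j => -normalStretch n j) 0 := by
  refine HasDerivAt.prodMk (hasDerivAt_pi.2 fun i => ?_) (hasDerivAt_pi.2 fun j => ?_)
  · simpa using ((hasDerivAt_id (0 : ℝ)).smul_const (vertexStretch n i)).const_add (stdVertex i)
  · have h1 : HasDerivAt (fun s : ℝ => s * (1 + s)⁻¹) 1 0 := by
      exact ((hasDerivAt_id (0 : ℝ)).mul
        (((hasDerivAt_id (0 : ℝ)).const_add 1).inv (by simp))).congr_deriv (by simp)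
    simpa using (h1.smul_const (normalStretch n j)).const_sub (stdNormal j)

/-- By the cut condition an incident vertex and normal are never on strictly opposite sides of the
hyperplane. If both are on the positive side, they move by the stretch and its inverse transpose,
the factor `s / (1 + s)` being `1 - 1 / (1 + s)`. If one lies on the hyperplane, any motion of the
other is orthogonal to it. Otherwise neither moves. -/
theorem inner_stretchCurve {n : Fin 4 → ℤ} (hn : intDot n n ≠ 0) (hcut : IsCellCut n)
    {i j : Fin 24} (hij : cellIncident i j) {s : ℝ} (hs : 1 + s ≠ 0) :
    inner ℝ ((stretchCurve n s).2 j) ((stretchCurve n s).1 i) = (1 : ℝ) := by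
  obtain ⟨h1, h2⟩ := hcut i j hij
  have h1' : ((max (intDot n (cellVertex i)) 0 : ℤ) : ℝ) * intDot n (cellNormal j) =
      (max (intDot n (cellVertex i)) 0 : ℤ) * (max (intDot n (cellNormal j)) 0 : ℤ) := by
    exact_mod_cast h1
  have h2' : ((max (intDot n (cellNormal j)) 0 : ℤ) : ℝ) * intDot n (cellVertex i) =
      (max (intDot n (cellVertex i)) 0 : ℤ) * (max (intDot n (cellNormal j)) 0 : ℤ) := by
    exact_mod_cast h2
  have hn' : (intDot n n : ℝ) ≠ 0 := by exact_mod_cast hn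
  have e1 : inner ℝ (stdNormal j) (stdVertex i) = (1 : ℝ) :=
    (inner_stdNormal_stdVertex_eq_one_iff i j).2 hij
  have e2 : inner ℝ (stdNormal j) (intVec n) = (intDot n (cellNormal j) : ℝ) / 2 := by
    rw [stdNormal, real_inner_smul_left, real_inner_comm, inner_intVec]
    ring
  have e3 : inner ℝ (intVec n) (stdVertex i) = (intDot n (cellVertex i) : ℝ) := inner_intVec _ _
  simp only [stretchCurve, vertexStretch, normalStretch, inner_sub_left, inner_add_right,
    real_inner_smul_left, real_inner_smul_right, e1, e2, e3, inner_intVec]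
  set x : ℝ := ((max (intDot n (cellVertex i)) 0 : ℤ) : ℝ)
  set y : ℝ := ((max (intDot n (cellNormal j)) 0 : ℤ) : ℝ)
  field_simp
  linear_combination (s * (1 + s)) * h1' - s * h2'

/-- The velocities of the two stretchings pair nontrivially under the stress. -/
theorem sum_cellStress_mul_inner_stretch :
    ∑ i, ∑ j, (cellStress i j : ℝ) *
      inner ℝ (-normalStretch ![1, 0, 0, 0] j + -normalStretch ![1, 1, 0, 0] j)
        (vertexStretch ![1, 0, 0, 0] i + vertexStretch ![1, 1, 0, 0] i) = -4 := by
  have h : ∑ i, ∑ j, (cellStress i j : ℝ) *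
      (2 * ((max (intDot ![1, 0, 0, 0] (cellNormal j)) 0 : ℤ) *
          (max (intDot ![1, 0, 0, 0] (cellVertex i)) 0 : ℤ)) +
        (max (intDot ![1, 0, 0, 0] (cellNormal j)) 0 : ℤ) *
          (max (intDot ![1, 1, 0, 0] (cellVertex i)) 0 : ℤ) +
        (max (intDot ![1, 1, 0, 0] (cellNormal j)) 0 : ℤ) *
          (max (intDot ![1, 0, 0, 0] (cellVertex i)) 0 : ℤ) +
        (max (intDot ![1, 1, 0, 0] (cellNormal j)) 0 : ℤ) *
          (max (intDot ![1, 1, 0, 0] (cellVertex i)) 0 : ℤ)) = (16 : ℝ) := by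
    exact_mod_cast sum_cellStress_mul_posPart
  have e11 : intDot ![1, 0, 0, 0] ![1, 0, 0, 0] = 1 := by decide +kernel
  have e12 : intDot ![1, 0, 0, 0] ![1, 1, 0, 0] = 1 := by decide +kernel
  have e21 : intDot ![1, 1, 0, 0] ![1, 0, 0, 0] = 1 := by decide +kernel
  have e22 : intDot ![1, 1, 0, 0] ![1, 1, 0, 0] = 2 := by decide +kernel
  -- The factor `-1/4` collects the sign of the normal velocities and the denominators of both
  -- stretches, with squared lengths `1` and `2`.
  rw [show (-4 : ℝ) = -4⁻¹ * 16 by norm_num, ← h, Finset.mul_sum]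
  refine Finset.sum_congr rfl fun i _ => ?_
  rw [Finset.mul_sum]
  refine Finset.sum_congr rfl fun j _ => ?_
  simp only [vertexStretch, normalStretch, inner_add_left, inner_add_right, inner_neg_left,
    real_inner_smul_left, real_inner_smul_right, inner_intVec, e11, e12, e21, e22, Int.cast_one,
    Int.cast_ofNat]
  ring

/-! ### Affine transport of realizations -/

/-- The image of a polytope under `x ↦ M x + t`, with vertices and facets relabeled. -/
noncomputable def affineTransport (M : EucSp 4 ≃L[ℝ] EucSp 4) (t : EucSp 4) (σ τ : Fin 24 ≃ Fin 24)
    (q : (Fin 24 → EucSp 4) × (Fin 24 → EucSp 4)) : (Fin 24 → EucSp 4) × (Fin 24 → EucSp 4) :=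
  (fun i => M (q.1 (σ.symm i)) + t, fun j =>
    (1 + inner ℝ ((M.symm : EucSp 4 →L[ℝ] EucSp 4).adjoint (q.2 (τ.symm j))) t)⁻¹ •
      (M.symm : EucSp 4 →L[ℝ] EucSp 4).adjoint (q.2 (τ.symm j)))

/-- The inverse of `affineTransport`. -/
noncomputable def affineTransportInv (M : EucSp 4 ≃L[ℝ] EucSp 4) (t : EucSp 4)
    (σ τ : Fin 24 ≃ Fin 24) (q : (Fin 24 → EucSp 4) × (Fin 24 → EucSp 4)) :
    (Fin 24 → EucSp 4) × (Fin 24 → EucSp 4) :=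
  (fun i => M.symm (q.1 (σ i) - t), fun j =>
    (1 - inner ℝ (q.2 (τ j)) t)⁻¹ • (M : EucSp 4 →L[ℝ] EucSp 4).adjoint (q.2 (τ j)))

section

variable {M : EucSp 4 ≃L[ℝ] EucSp 4} {t : EucSp 4} {σ τ : Fin 24 ≃ Fin 24}
  {q : (Fin 24 → EucSp 4) × (Fin 24 → EucSp 4)}

theorem adjoint_symm_adjoint (x : EucSp 4) :
    (M.symm : EucSp 4 →L[ℝ] EucSp 4).adjoint ((M : EucSp 4 →L[ℝ] EucSp 4).adjoint x) = x := by
  refine ext_inner_right ℝ fun y => ?_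
  rw [ContinuousLinearMap.adjoint_inner_left, ContinuousLinearMap.adjoint_inner_left]
  simp

theorem adjoint_adjoint_symm (x : EucSp 4) :
    (M : EucSp 4 →L[ℝ] EucSp 4).adjoint ((M.symm : EucSp 4 →L[ℝ] EucSp 4).adjoint x) = x := by
  refine ext_inner_right ℝ fun y => ?_
  rw [ContinuousLinearMap.adjoint_inner_left, ContinuousLinearMap.adjoint_inner_left]
  simp

/-- On the image, `⟪a, x⟫ = 1` reads `⟪b, y⟫ = 1 + ⟪b, t⟫` with `b` the transported normal; dividing
by the right side restores the value `1`, so that side must be nonzero. -/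
theorem inner_affineTransport {i j : Fin 24} (h : inner ℝ (q.2 j) (q.1 i) = (1 : ℝ))
    (hne : 1 + inner ℝ ((M.symm : EucSp 4 →L[ℝ] EucSp 4).adjoint (q.2 j)) t ≠ (0 : ℝ)) :
    inner ℝ ((affineTransport M t σ τ q).2 (τ j)) ((affineTransport M t σ τ q).1 (σ i)) =
      (1 : ℝ) := by
  simp only [affineTransport, Equiv.symm_apply_apply, real_inner_smul_left, inner_add_right]
  rw [ContinuousLinearMap.adjoint_inner_left _ (M (q.1 i))]
  simp only [ContinuousLinearEquiv.coe_coe, ContinuousLinearEquiv.symm_apply_apply, h]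
  rw [← mul_add]
  exact inv_mul_cancel₀ hne

theorem inner_affineTransportInv {i j : Fin 24}
    (h : inner ℝ (q.2 (τ j)) (q.1 (σ i)) = (1 : ℝ)) (hne : 1 - inner ℝ (q.2 (τ j)) t ≠ (0 : ℝ)) :
    inner ℝ ((affineTransportInv M t σ τ q).2 j) ((affineTransportInv M t σ τ q).1 i) =
      (1 : ℝ) := by
  simp only [affineTransportInv, real_inner_smul_left, ContinuousLinearMap.adjoint_inner_left,
    ContinuousLinearEquiv.coe_coe, ContinuousLinearEquiv.apply_symm_apply, inner_sub_right, h]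
  exact inv_mul_cancel₀ hne

theorem affineTransportInv_affineTransport
    (hne : ∀ j, 1 + inner ℝ ((M.symm : EucSp 4 →L[ℝ] EucSp 4).adjoint (q.2 j)) t ≠ (0 : ℝ)) :
    affineTransportInv M t σ τ (affineTransport M t σ τ q) = q := by
  refine Prod.ext (funext fun i => ?_) (funext fun j => ?_)
  · simp [affineTransport, affineTransportInv]
  · simp only [affineTransport, affineTransportInv, Equiv.symm_apply_apply, real_inner_smul_left,
      map_smul, adjoint_adjoint_symm, smul_smul]
    have := hne j
    set c : ℝ := inner ℝ ((M.symm : EucSp 4 →L[ℝ] EucSp 4).adjoint (q.2 j)) t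
    have h1 : (1 - (1 + c)⁻¹ * c)⁻¹ * (1 + c)⁻¹ = 1 := by
      have h2 : 1 - (1 + c)⁻¹ * c = (1 + c)⁻¹ := by
        field_simp
        ring
      rw [h2, inv_inv, mul_inv_cancel₀ this]
    rw [h1, one_smul]

theorem affineTransport_affineTransportInv
    (hne : ∀ j, 1 - inner ℝ (q.2 j) t ≠ (0 : ℝ)) :
    affineTransport M t σ τ (affineTransportInv M t σ τ q) = q := by
  refine Prod.ext (funext fun i => ?_) (funext fun j => ?_)
  · simp [affineTransport, affineTransportInv]
  · simp only [affineTransport, affineTransportInv, Equiv.apply_symm_apply, real_inner_smul_left,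
      map_smul, adjoint_symm_adjoint, smul_smul]
    have := hne j
    set c : ℝ := inner ℝ (q.2 j) t
    have h1 : (1 + (1 - c)⁻¹ * c)⁻¹ * (1 - c)⁻¹ = 1 := by
      have h2 : 1 + (1 - c)⁻¹ * c = (1 - c)⁻¹ := by
        field_simp
        ring
      rw [h2, inv_inv, mul_inv_cancel₀ this]
    rw [h1, one_smul]

theorem differentiableAt_affineTransport
    (hne : ∀ j, 1 + inner ℝ ((M.symm : EucSp 4 →L[ℝ] EucSp 4).adjoint (q.2 j)) t ≠ (0 : ℝ)) :
    DifferentiableAt ℝ (affineTransport M t σ τ) q := by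
  unfold affineTransport
  refine DifferentiableAt.prodMk (differentiableAt_pi.2 fun i => by fun_prop)
    (differentiableAt_pi.2 fun j => ?_)
  have := hne (τ.symm j)
  have h : DifferentiableAt ℝ (fun q : (Fin 24 → EucSp 4) × (Fin 24 → EucSp 4) =>
      inner ℝ ((M.symm : EucSp 4 →L[ℝ] EucSp 4).adjoint (q.2 (τ.symm j))) t) q :=
    DifferentiableAt.inner ℝ (by fun_prop) (by fun_prop)
  have h' : DifferentiableAt ℝ (fun q : (Fin 24 → EucSp 4) × (Fin 24 → EucSp 4) =>
      (M.symm : EucSp 4 →L[ℝ] EucSp 4).adjoint (q.2 (τ.symm j))) q := by fun_prop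
  exact ((h.const_add 1).inv this).smul h'

theorem contDiffAt_affineTransportInv (hne : ∀ j, 1 - inner ℝ (q.2 j) t ≠ (0 : ℝ)) :
    ContDiffAt ℝ 2 (affineTransportInv M t σ τ) q := by
  unfold affineTransportInv
  refine ContDiffAt.prodMk (contDiffAt_pi.2 fun i => by fun_prop)
    (contDiffAt_pi.2 fun j => ?_)
  have h : ContDiffAt ℝ 2 (fun q : (Fin 24 → EucSp 4) × (Fin 24 → EucSp 4) =>
      inner ℝ (q.2 (τ j)) t) q := ContDiffAt.inner ℝ (by fun_prop) (by fun_prop)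
  have h' : ContDiffAt ℝ 2 (fun q : (Fin 24 → EucSp 4) × (Fin 24 → EucSp 4) =>
      (M : EucSp 4 →L[ℝ] EucSp 4).adjoint (q.2 (τ j))) q := by fun_prop
  exact ((contDiffAt_const.sub h).inv (hne (τ j))).smul h'

end

/-! ### The contradiction at a regular realization -/

theorem mainTheorem3 (P : LabeledPolytope 4 24 24) (hP : P.carrier = twentyFourCell)
    (p : (Fin 24 → EucSp 4) × (Fin 24 → EucSp 4)) (hp : p ∈ P.centeredRealizationSpace)
    (hreg : IsRegularPolytope (convexHull ℝ (Set.range p.1))) :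
    ¬ IsSmoothSubmanifoldAt P.centeredRealizationSpace p := by
  intro hsm
  obtain ⟨σ, τ, hσ, hτ⟩ := P.exists_equiv_of_twentyFourCell hP
  obtain ⟨M, t, hM⟩ := LabeledPolytope.exists_continuousLinearEquiv hP hσ hτ hp hreg
  have hloc : ∀ᶠ q in nhds p, q ∈ P.centeredRealizationSpace ↔
      ∀ i j, cellIncident i j → inner ℝ (q.2 (τ j)) (q.1 (σ i)) = (1 : ℝ) := by
    filter_upwards [P.eventually_mem_centeredRealizationSpace_iff (by norm_num) hp] with q hq
    rw [hq]
    refine ⟨fun h i j hij => h _ _ (by rwa [hσ, hτ, stdVertex_mem_stdFacet]), fun h i j hij => ?_⟩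
    obtain ⟨i, rfl⟩ := σ.surjective i
    obtain ⟨j, rfl⟩ := τ.surjective j
    rw [hσ, hτ, stdVertex_mem_stdFacet] at hij
    exact h i j hij
  -- The pulled-back normal is constant on the vertices of the standard facet, which determines it.
  have hMB : ∀ j, (M : EucSp 4 →L[ℝ] EucSp 4).adjoint (p.2 (τ j)) =
      (1 - inner ℝ (p.2 (τ j)) t) • stdNormal j := by
    intro j
    refine eq_smul_stdNormal fun i hij => ?_
    have h1 := (LabeledPolytope.inner_eq_one_iff_cellIncident hσ hτ hp i j).2 hij
    rw [hM, inner_add_right] at h1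
    rw [ContinuousLinearMap.adjoint_inner_left]
    simp only [ContinuousLinearEquiv.coe_coe]
    linarith
  -- A zero denominator would force the normal itself to vanish, although it has inner product `1`
  -- with some vertex.
  have hne : ∀ j, 1 - inner ℝ (p.2 j) t ≠ (0 : ℝ) := by
    intro j h0
    obtain ⟨j, rfl⟩ := τ.surjective j
    have h1 := hMB j
    rw [h0, zero_smul] at h1
    have h2 : p.2 (τ j) = 0 := by
      rw [← adjoint_symm_adjoint (M := M) (p.2 (τ j)), h1, map_zero]
    obtain ⟨i, hij⟩ := exists_cellIncident j
    exact ne_zero_of_inner_eq_one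
      ((LabeledPolytope.inner_eq_one_iff_cellIncident hσ hτ hp i j).2 hij) h2
  have hinv : affineTransportInv M t σ τ p = (stdVertex, stdNormal) := by
    refine Prod.ext (funext fun i => ?_) (funext fun j => ?_)
    · simp [affineTransportInv, hM]
    · simp only [affineTransportInv]
      rw [hMB, smul_smul, inv_mul_cancel₀ (hne _), one_smul]
  have hfwd : affineTransport M t σ τ (stdVertex, stdNormal) = p := by
    rw [← hinv, affineTransport_affineTransportInv hne]
  have hne' : ∀ j, 1 + inner ℝ ((M.symm : EucSp 4 →L[ℝ] EucSp 4).adjoint (stdNormal j)) t ≠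
      (0 : ℝ) := by
    intro j
    have h1 : stdNormal j = (1 - inner ℝ (p.2 (τ j)) t)⁻¹ •
        (M : EucSp 4 →L[ℝ] EucSp 4).adjoint (p.2 (τ j)) := by
      rw [hMB, smul_smul, inv_mul_cancel₀ (hne _), one_smul]
    rw [h1, map_smul, adjoint_symm_adjoint, real_inner_smul_left]
    have := hne (τ j)
    have h2 : 1 + (1 - inner ℝ (p.2 (τ j)) t)⁻¹ * inner ℝ (p.2 (τ j)) t =
        (1 - inner ℝ (p.2 (τ j)) t)⁻¹ := by
      field_simp
      ring
    rw [h2]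
    exact inv_ne_zero this
  -- Each stretching curve is transported to `p`. Its velocity `u` there is described only through
  -- its image under the derivative of the inverse transport, which is all that is used later.
  have hcurve : ∀ n : Fin 4 → ℤ, intDot n n ≠ 0 → IsCellCut n →
      ∃ (c : ℝ → (Fin 24 → EucSp 4) × (Fin 24 → EucSp 4)) (u : _), HasDerivAt c u 0 ∧ c 0 = p ∧
        (∀ᶠ s in nhds 0, c s ∈ P.centeredRealizationSpace) ∧
        fderiv ℝ (affineTransportInv M t σ τ) p u =
          (vertexStretch n, fun j => -normalStretch n j) := by
    intro n hn hcut
    have hd := hasDerivAt_stretchCurve n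
    have h0 := stretchCurve_zero n
    have hdT : DifferentiableAt ℝ (affineTransport M t σ τ) (stretchCurve n 0) := by
      rw [h0]
      exact differentiableAt_affineTransport hne'
    have hdc := hdT.hasFDerivAt.comp_hasDerivAt 0 hd
    have hc0 : affineTransport M t σ τ (stretchCurve n 0) = p := by rw [h0, hfwd]
    have hev : ∀ᶠ s in nhds (0 : ℝ), ∀ j,
        1 + inner ℝ ((M.symm : EucSp 4 →L[ℝ] EucSp 4).adjoint ((stretchCurve n s).2 j)) t ≠
          (0 : ℝ) := by
      rw [Filter.eventually_all]
      intro j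
      have hcont : Continuous fun q : (Fin 24 → EucSp 4) × (Fin 24 → EucSp 4) =>
          1 + inner ℝ ((M.symm : EucSp 4 →L[ℝ] EucSp 4).adjoint (q.2 j)) t := by fun_prop
      have h1 := (hcont.continuousAt (x := stretchCurve n 0)).comp hd.continuousAt
      exact h1.eventually_ne (by simpa [h0] using hne' j)
    have hs : ∀ᶠ s in nhds (0 : ℝ), 1 + s ≠ 0 := by
      have hcont : Continuous fun s : ℝ => 1 + s := by fun_prop
      exact hcont.continuousAt.eventually_ne (by simp)
    refine ⟨fun s => affineTransport M t σ τ (stretchCurve n s), _, hdc, hc0, ?_, ?_⟩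
    · have hloc' : ∀ᶠ s in nhds (0 : ℝ),
          affineTransport M t σ τ (stretchCurve n s) ∈ P.centeredRealizationSpace ↔ _ :=
        hdc.continuousAt.eventually (by rw [Function.comp_apply, hc0]; exact hloc)
      filter_upwards [hloc', hev, hs] with s h1 h2 h3
      exact h1.2 fun i j hij => inner_affineTransport (inner_stretchCurve hn hcut hij h3) (h2 j)
    · have h1 : HasFDerivAt (affineTransportInv M t σ τ)
          (fderiv ℝ (affineTransportInv M t σ τ) p)
          ((affineTransport M t σ τ ∘ stretchCurve n) 0) := by
        rw [Function.comp_apply, hc0]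
        exact ((contDiffAt_affineTransportInv hne).differentiableAt (by simp)).hasFDerivAt
      -- The inverse transport undoes the transport along the curve, so the chain rule returns the
      -- original stretching velocity.
      refine (h1.comp_hasDerivAt 0 hdc).unique (hd.congr_of_eventuallyEq ?_)
      filter_upwards [hev] with s h2
      exact affineTransportInv_affineTransport h2
  obtain ⟨c₁, u₁, h₁, h₁p, h₁S, h₁u⟩ := hcurve ![1, 0, 0, 0] (by decide +kernel) isCellCut_axis
  obtain ⟨c₂, u₂, h₂, h₂p, h₂S, h₂u⟩ := hcurve ![1, 1, 0, 0] (by decide +kernel) isCellCut_root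
  obtain ⟨c, hc, hcp, hcd, hcS⟩ := hsm.exists_curve_add h₁ h₂ h₁p h₂p h₁S h₂S
  have hdiff : ContDiffAt ℝ 2 (affineTransportInv M t σ τ) (c 0) := by
    rw [hcp]
    exact contDiffAt_affineTransportInv hne
  have hg : ContDiffAt ℝ 2 (fun s => affineTransportInv M t σ τ (c s)) 0 := hdiff.comp 0 hc
  have hgd : HasDerivAt (fun s => affineTransportInv M t σ τ (c s))
      ((vertexStretch ![1, 0, 0, 0], fun j => -normalStretch ![1, 0, 0, 0] j) +
        (vertexStretch ![1, 1, 0, 0], fun j => -normalStretch ![1, 1, 0, 0] j)) 0 := by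
    have h1 := (hdiff.differentiableAt (by simp)).hasFDerivAt.comp_hasDerivAt 0 hcd
    rwa [hcp, map_add, h₁u, h₂u] at h1
  have hv : ∀ i, HasDerivAt (fun s => (affineTransportInv M t σ τ (c s)).1 i)
      (vertexStretch ![1, 0, 0, 0] i + vertexStretch ![1, 1, 0, 0] i) 0 :=
    fun i => hasDerivAt_pi.1 hgd.fst i
  have ha : ∀ j, HasDerivAt (fun s => (affineTransportInv M t σ τ (c s)).2 j)
      (-normalStretch ![1, 0, 0, 0] j + -normalStretch ![1, 1, 0, 0] j) 0 :=
    fun j => hasDerivAt_pi.1 hgd.snd j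
  have hnec : ∀ᶠ s in nhds (0 : ℝ), ∀ j, 1 - inner ℝ ((c s).2 j) t ≠ (0 : ℝ) := by
    rw [Filter.eventually_all]
    intro j
    have hcont : Continuous fun q : (Fin 24 → EucSp 4) × (Fin 24 → EucSp 4) =>
        1 - inner ℝ (q.2 j) t := by fun_prop
    have h1 := (hcont.continuousAt (x := c 0)).comp hcd.continuousAt
    exact h1.eventually_ne (by simpa [hcp] using hne j)
  have hlocc : ∀ᶠ s in nhds (0 : ℝ), c s ∈ P.centeredRealizationSpace ↔ _ :=
    hcd.continuousAt.eventually (by rw [hcp]; exact hloc)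
  -- Pulled back to the standard 24-cell, the curve with the summed velocity still satisfies all
  -- incidence equations, so the quadratic form of the stress would vanish on that velocity, where
  -- it equals `-4`.
  have hzero := sum_cellStress_mul_inner_deriv_eq_zero
    (v := fun i s => (affineTransportInv M t σ τ (c s)).1 i)
    (a := fun j s => (affineTransportInv M t σ τ (c s)).2 j)
    (fun i => contDiffAt_pi.1 hg.fst i) (fun j => contDiffAt_pi.1 hg.snd j)
    (fun i => by simp only [hcp, hinv]) (fun j => by simp only [hcp, hinv])
    fun i j hij => by
      filter_upwards [hnec, hlocc, hcS] with s h1 h2 h3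
      exact inner_affineTransportInv (h2.1 h3 i j hij) (h1 _)
  simp only [fun i => (hv i).deriv, fun j => (ha j).deriv] at hzero
  rw [sum_cellStress_mul_inner_stretch] at hzero
  norm_num at hzero
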